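/- Notation. $U$ is the hyperbolic plane, with Gram matrix $\begin{pmatrix}0&1\\1&0\end{pmatrix}$; $\langle n\rangle$ is the rank one lattice with a generator of square $n$; $\oplus$ is the orthogonal direct sum and $kL$ is the orthogonal sum of $k$ copies of $L$. For a non-degenerate lattice $L$, $\operatorname{O}^+(L)$ is the group of isometries of $L$ whose extension to $L\otimes\mathbb{R}$ has trivial real spinor norm, where the spinor norm of a product of reflections $\sigma_{w_1}\cdots\sigma_{w_m}$, $\sigma_w(x)=x-\frac{2(x,w)}{(w,w)}w$, is the class of $\prod_i\bigl(-(w_i,w_i)/2\bigr)$ in $\mathbb{R}^*/(\mathbb{R}^*)^2$. For $0\ne x\in L$, $\operatorname{div}(x)$ is the positive generator of the ideal $(x,L)\subset\mathbb{Z}$, and $x^*=x/\operatorname{div}(x)\in L\otimes\mathbb{Q}$. Put $$M=3U\oplus\langle-6\rangle$$ (the Beauville–Bogomolov–Fujiki lattice of a fourfold of generalised Kummer deformation type), and for an integer $d\ge1$ put $$L_{2d}=2U\oplus\langle-2d\rangle\oplus\langle-6\rangle,\qquad \Gamma_{2d}=\{g\in\operatorname{O}^+(L_{2d}) : g v^*\equiv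 v^* \bmod L_{2d}\},$$ where $v$ generates the factor $\langle-2d\rangle$ of $L_{2d}$. **Proposition 2.1.** (1) Let $2d>4$ and let $h\in M$ satisfy $h^2=2d$ and $\operatorname{div}(h)=1$ (so $h$ is primitive; for instance, $h$ may be the class of a split polarisation of degree $2d$). Then the group $\operatorname{O}^+(M,h)=\{g\in\operatorname{O}^+(M): gh=h\}$ is isomorphic to $\Gamma_{2d}$. More precisely, there are an isometry $\varphi:h^\perp\to L_{2d}$ and a group isomorphism $\Phi:\operatorname{O}^+(M,h)\to\Gamma_{2d}$ such that $\varphi^{-1}\circ\Phi(g)\circ\varphi=g|_{h^\perp}$ for all $g\in\operatorname{O}^+(M,h)$. (2) Let $p>3$ be prime, and let $\iota:L_{2p^2}\to L_2$ be the isometric embedding that is the identity on $2U\oplus\langle-6\rangle$ and sends the generator of $\langle-2p^2\rangle$ to $p$ times the generator of $\langle-2\rangle$. Then $\Gamma_{2p^2}\subset\Gamma_2$ via $\iota$: there is an injective group homomorphism $j:\Gamma_{2p^2}\to\Gamma_2$ such that $j(g)\circ\iota=\iota\circ g$ for all $g\in\Gamma_{2p^2}$. -/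

import Mathlib

open scoped TensorProduct

noncomputable section

namespace KummerLattice

/-! ### Orthogonal groups and the spinor norm -/

section General

variable {R : Type*} [CommRing R] {V : Type*} [AddCommGroup V] [Module R V]

/-- The orthogonal group `O(V)` of a module with a bilinear form. -/
def orthogonalGroup (B : LinearMap.BilinForm R V) : Subgroup (V ≃ₗ[R] V) where
  carrier := {g | ∀ x y, B (g x) (g y) = B x y}
  one_mem' := fun _ _ => rfl
  mul_mem' := fun {a b} ha hb x y => by
    simp only [LinearEquiv.mul_apply, ha (b x) (b y), hb x y]
  inv_mem' := fun {a} ha x y => by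
    have h := ha (a⁻¹ x) (a⁻¹ y)
    have e : ∀ z, a (a⁻¹ z) = z := fun z => a.apply_symm_apply z
    rw [e, e] at h
    exact h.symm

end General

section Real

variable {V : Type*} [AddCommGroup V] [Module ℝ V]

/-- The reflection `σ_w : x ↦ x - (2 (x, w) / (w, w)) w` (meaningful when `(w, w) ≠ 0`). -/
def reflectionIn (B : LinearMap.BilinForm ℝ V) (w : V) : Module.End ℝ V :=
  LinearMap.id - (B.flip w).smulRight ((2 / B w w) • w)

theorem reflectionIn_apply (B : LinearMap.BilinForm ℝ V) (w x : V) :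
    reflectionIn B w x = x - (2 * B x w / B w w) • w := by
  change x - B x w • (2 / B w w) • w = _
  rw [smul_smul]
  congr 2
  ring

theorem reflectionIn_mul_self (B : LinearMap.BilinForm ℝ V) {w : V} (hw : B w w ≠ 0) :
    reflectionIn B w * reflectionIn B w = 1 := by
  ext x
  have e : B (reflectionIn B w x) w = -B x w := by
    rw [reflectionIn_apply, map_sub, map_smul, LinearMap.sub_apply, LinearMap.smul_apply, smul_eq_mul]
    field_simp
    ring
  rw [Module.End.mul_apply, Module.End.one_apply, reflectionIn_apply B w (reflectionIn B w x), e, reflectionIn_apply,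
    sub_sub, ← add_smul]
  have : 2 * B x w / B w w + 2 * -B x w / B w w = 0 := by ring
  rw [this, zero_smul, sub_zero]

/-- `c` represents the real spinor norm of `g`: `g` is a product `σ_{w₁} ⋯ σ_{w_m}` of reflections
in vectors with `(w_i, w_i) ≠ 0`, and `c = ∏ (-(w_i, w_i) / 2)`.  The spinor norm itself is
the class of `c` in `ℝˣ / (ℝˣ)²`. -/
def RepresentsSpinorNorm (B : LinearMap.BilinForm ℝ V) (g : V ≃ₗ[ℝ] V) (c : ℝ) : Prop :=
  ∃ ws : List V, (∀ w ∈ ws, B w w ≠ 0) ∧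
    (g : Module.End ℝ V) = (ws.map (reflectionIn B)).prod ∧
    c = (ws.map fun w => -(B w w) / 2).prod

theorem RepresentsSpinorNorm.mul {B : LinearMap.BilinForm ℝ V} {g g' : V ≃ₗ[ℝ] V} {c c' : ℝ}
    (h : RepresentsSpinorNorm B g c) (h' : RepresentsSpinorNorm B g' c') :
    RepresentsSpinorNorm B (g * g') (c * c') := by
  obtain ⟨ws, h1, h2, h3⟩ := h
  obtain ⟨ws', h1', h2', h3'⟩ := h'
  refine ⟨ws ++ ws', ?_, ?_, ?_⟩
  · intro w hw
    rcases List.mem_append.1 hw with hw | hw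
    · exact h1 w hw
    · exact h1' w hw
  · rw [List.map_append, List.prod_append, ← h2, ← h2']
    rfl
  · rw [List.map_append, List.prod_append, h3, h3']

theorem RepresentsSpinorNorm.inv {B : LinearMap.BilinForm ℝ V} {g : V ≃ₗ[ℝ] V} {c : ℝ}
    (h : RepresentsSpinorNorm B g c) : RepresentsSpinorNorm B g⁻¹ c := by
  obtain ⟨ws, h1, h2, h3⟩ := h
  refine ⟨ws.reverse, fun w hw => h1 w (List.mem_reverse.1 hw), ?_, ?_⟩
  · have key : ∀ l : List V, (∀ w ∈ l, B w w ≠ 0) →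
        (l.reverse.map (reflectionIn B)).prod * (l.map (reflectionIn B)).prod = 1 := by
      intro l
      induction l with
      | nil => intro _; simp
      | cons a l ih =>
        intro hl
        have ha : B a a ≠ 0 := hl a (by simp)
        have hl' := ih fun w hw => hl w (by simp [hw])
        simp only [List.reverse_cons, List.map_append, List.map_cons, List.map_nil,
          List.prod_append, List.prod_cons, List.prod_nil, mul_one]
        calc _ = (l.reverse.map (reflectionIn B)).prod * (reflectionIn B a * reflectionIn B a) *
              (l.map (reflectionIn B)).prod := by simp only [mul_assoc]
          _ = 1 := by rw [reflectionIn_mul_self B ha, mul_one, hl']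
    have h4 := key ws h1
    rw [← h2] at h4
    have h5 : (g : Module.End ℝ V) * (g⁻¹ : V ≃ₗ[ℝ] V) = 1 := by
      ext x
      exact g.apply_symm_apply x
    calc ((g⁻¹ : V ≃ₗ[ℝ] V) : Module.End ℝ V) = 1 * (g⁻¹ : V ≃ₗ[ℝ] V) := (one_mul _).symm
      _ = _ := by rw [← h4, mul_assoc, h5, mul_one]
  · rw [h3, ← List.prod_reverse, List.map_reverse]

/-- `O⁺(V)`: the kernel of the real spinor norm on `O(V)`, i.e. the isometries whose spinor norm
is the class of squares. -/
def spinorKernel (B : LinearMap.BilinForm ℝ V) : Subgroup (V ≃ₗ[ℝ] V) where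
  carrier := {g | g ∈ orthogonalGroup B ∧ ∃ c, RepresentsSpinorNorm B g c ∧ IsSquare c}
  one_mem' := ⟨one_mem _, 1, ⟨[], by simp, rfl, by simp⟩, IsSquare.one⟩
  mul_mem' := fun {a b} ⟨ha, c, hc, hs⟩ ⟨hb, c', hc', hs'⟩ =>
    ⟨mul_mem ha hb, c * c', hc.mul hc', hs.mul hs'⟩
  inv_mem' := fun {a} ⟨ha, c, hc, hs⟩ => ⟨inv_mem ha, c, hc.inv, hs⟩

end Real

/-! ### Lattices -/

section Lattice

variable {Λ : Type*} [AddCommGroup Λ]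

/-- `O⁺(Λ) = O(Λ) ∩ O⁺(Λ ⊗ ℝ)`. -/
def orthogonalGroupPlus (B : LinearMap.BilinForm ℤ Λ) : Subgroup (Λ ≃ₗ[ℤ] Λ) where
  carrier := {g | g ∈ orthogonalGroup B ∧
    g.baseChange ℤ ℝ Λ Λ ∈ spinorKernel (LinearMap.BilinForm.baseChange ℝ B)}
  one_mem' := ⟨one_mem _, by rw [LinearEquiv.baseChange_one]; exact one_mem _⟩
  mul_mem' := fun {a b} ha hb =>
    ⟨mul_mem ha.1 hb.1, by rw [LinearEquiv.baseChange_mul]; exact mul_mem ha.2 hb.2⟩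
  inv_mem' := fun {a} ha =>
    ⟨inv_mem ha.1, by rw [LinearEquiv.baseChange_inv]; exact inv_mem ha.2⟩

/-- `div(x)`: the non-negative generator of the ideal `(x, Λ) ⊆ ℤ`. -/
def divisor (B : LinearMap.BilinForm ℤ Λ) (x : Λ) : ℕ :=
  (Submodule.IsPrincipal.generator (LinearMap.range (B x))).natAbs

/-- `x* = x / div(x)`, as an element of `Λ ⊗ ℚ`. -/
def starVec (B : LinearMap.BilinForm ℤ Λ) (x : Λ) : ℚ ⊗[ℤ] Λ :=
  ((divisor B x : ℚ)⁻¹) ⊗ₜ[ℤ] x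

/-- `Λ` as a subgroup of `Λ ⊗ ℚ`. -/
def integral (Λ : Type*) [AddCommGroup Λ] : Submodule ℤ (ℚ ⊗[ℤ] Λ) :=
  LinearMap.range (TensorProduct.mk ℤ ℚ Λ 1)

theorem baseChange_mem_integral (g : Λ ≃ₗ[ℤ] Λ) {z : ℚ ⊗[ℤ] Λ} (hz : z ∈ integral Λ) :
    g.baseChange ℤ ℚ Λ Λ z ∈ integral Λ := by
  obtain ⟨x, rfl⟩ := hz
  exact ⟨g x, rfl⟩

/-- `{g ∈ O⁺(Λ) | g z ≡ z mod Λ}`, for `z ∈ Λ ⊗ ℚ`. -/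
def fixingModLattice (B : LinearMap.BilinForm ℤ Λ) (z : ℚ ⊗[ℤ] Λ) :
    Subgroup (Λ ≃ₗ[ℤ] Λ) where
  carrier := {g | g ∈ orthogonalGroupPlus B ∧ g.baseChange ℤ ℚ Λ Λ z - z ∈ integral Λ}
  one_mem' := ⟨one_mem _, by rw [LinearEquiv.baseChange_one]; simp⟩
  mul_mem' := fun {a b} ha hb => ⟨mul_mem ha.1 hb.1, by
    rw [LinearEquiv.baseChange_mul, LinearEquiv.mul_apply]
    have h := add_mem (baseChange_mem_integral a hb.2) ha.2
    rwa [map_sub, sub_add_sub_cancel] at h⟩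
  inv_mem' := fun {a} ha => ⟨inv_mem ha.1, by
    have h := neg_mem (baseChange_mem_integral a⁻¹ ha.2)
    rw [map_sub, neg_sub, LinearEquiv.baseChange_inv] at h
    rw [LinearEquiv.baseChange_inv]
    have e : (a.baseChange ℤ ℚ Λ Λ)⁻¹ (a.baseChange ℤ ℚ Λ Λ z) = z :=
      (a.baseChange ℤ ℚ Λ Λ).symm_apply_apply z
    rwa [e] at h⟩

/-- `O⁺(Λ, h) = {g ∈ O⁺(Λ) | g h = h}`. -/
def orthogonalGroupPlusFixing (B : LinearMap.BilinForm ℤ Λ) (h : Λ) :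
    Subgroup (Λ ≃ₗ[ℤ] Λ) where
  carrier := {g | g ∈ orthogonalGroupPlus B ∧ g h = h}
  one_mem' := ⟨one_mem _, rfl⟩
  mul_mem' := fun {a b} ha hb => ⟨mul_mem ha.1 hb.1, by
    rw [LinearEquiv.mul_apply, hb.2, ha.2]⟩
  inv_mem' := fun {a} ha => ⟨inv_mem ha.1, by
    have e : a⁻¹ (a h) = h := a.symm_apply_apply h
    rwa [ha.2] at e⟩

/-- The sublattice `h^⊥`. -/
def perp (B : LinearMap.BilinForm ℤ Λ) (h : Λ) : Submodule ℤ Λ :=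
  B.orthogonal (Submodule.span ℤ {h})

end Lattice

/-! ### The lattices `M` and `L_{2d}` -/

/-- The orthogonal direct sum. -/
def oplus {Λ₁ Λ₂ : Type*} [AddCommGroup Λ₁] [AddCommGroup Λ₂]
    (B₁ : LinearMap.BilinForm ℤ Λ₁) (B₂ : LinearMap.BilinForm ℤ Λ₂) :
    LinearMap.BilinForm ℤ (Λ₁ × Λ₂) :=
  B₁.compl₁₂ (LinearMap.fst ℤ Λ₁ Λ₂) (LinearMap.fst ℤ Λ₁ Λ₂) +
    B₂.compl₁₂ (LinearMap.snd ℤ Λ₁ Λ₂) (LinearMap.snd ℤ Λ₁ Λ₂)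

/-- The rank one lattice `⟨n⟩`. -/
def rankOne (n : ℤ) : LinearMap.BilinForm ℤ ℤ := n • LinearMap.mul ℤ ℤ

/-- The hyperbolic plane `U`: the Gram matrix of the standard basis of `ℤ²` is `(0 1; 1 0)`. -/
def hypPlane : LinearMap.BilinForm ℤ (ℤ × ℤ) :=
  (LinearMap.mul ℤ ℤ).compl₁₂ (LinearMap.fst ℤ ℤ ℤ) (LinearMap.snd ℤ ℤ ℤ) +
    (LinearMap.mul ℤ ℤ).compl₁₂ (LinearMap.snd ℤ ℤ ℤ) (LinearMap.fst ℤ ℤ ℤ)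

theorem oplus_apply {Λ₁ Λ₂ : Type*} [AddCommGroup Λ₁] [AddCommGroup Λ₂] (B₁ : LinearMap.BilinForm ℤ Λ₁) (B₂ : LinearMap.BilinForm ℤ Λ₂)
    (x y : Λ₁ × Λ₂) : oplus B₁ B₂ x y = B₁ x.1 y.1 + B₂ x.2 y.2 := rfl

theorem rankOne_apply (n x y : ℤ) : rankOne n x y = n * (x * y) := rfl

theorem hypPlane_apply (x y : ℤ × ℤ) : hypPlane x y = x.1 * y.2 + x.2 * y.1 := rfl

/-- The underlying group of `M`. -/
abbrev MCarrier : Type := (ℤ × ℤ) × (ℤ × ℤ) × (ℤ × ℤ) × ℤ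

/-- `M = 3U ⊕ ⟨-6⟩`. -/
def formM : LinearMap.BilinForm ℤ MCarrier :=
  oplus hypPlane (oplus hypPlane (oplus hypPlane (rankOne (-6))))

/-- The underlying group of `L_{2d}`. -/
abbrev LCarrier : Type := (ℤ × ℤ) × (ℤ × ℤ) × ℤ × ℤ

/-- `L_{2d} = 2U ⊕ ⟨-2d⟩ ⊕ ⟨-6⟩`. -/
def formL (d : ℕ) : LinearMap.BilinForm ℤ LCarrier :=
  oplus hypPlane (oplus hypPlane (oplus (rankOne (-2 * (d : ℤ))) (rankOne (-6))))

/-- The generator `v` of the factor `⟨-2d⟩` of `L_{2d}`. -/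
def vGen : LCarrier := (0, 0, 1, 0)

/-- `Γ_{2d} = {g ∈ O⁺(L_{2d}) | g v* ≡ v* mod L_{2d}}`. -/
def Gam (d : ℕ) : Subgroup (LCarrier ≃ₗ[ℤ] LCarrier) :=
  fixingModLattice (formL d) (starVec (formL d) vGen)

/-- The map `L_{2p²} → L_2` which is the identity on `2U ⊕ ⟨-6⟩` and sends the generator of
`⟨-2p²⟩` to `p` times the generator of `⟨-2⟩`. -/
def emb (p : ℕ) : LCarrier →ₗ[ℤ] LCarrier :=
  LinearMap.id.prodMap (LinearMap.id.prodMap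
    (((p : ℤ) • (LinearMap.id : ℤ →ₗ[ℤ] ℤ)).prodMap LinearMap.id))

theorem emb_apply (p : ℕ) (x y : ℤ × ℤ) (a b : ℤ) :
    emb p (x, y, a, b) = (x, y, (p : ℤ) * a, b) := rfl

/-- The map `L_{2p²} → L_2` is isometric. -/
theorem emb_isometric (p : ℕ) (x y : LCarrier) :
    formL 1 (emb p x) (emb p y) = formL (p ^ 2) x y := by
  obtain ⟨x1, x2, x3, x4⟩ := x
  obtain ⟨y1, y2, y3, y4⟩ := y
  simp only [emb_apply, formL, oplus_apply, rankOne_apply]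
  push_cast
  ring

theorem emb_injective (p : ℕ) (hp : p ≠ 0) : Function.Injective (emb p) := by
  rintro ⟨x1, x2, x3, x4⟩ ⟨y1, y2, y3, y4⟩ h
  simpa [emb_apply, hp] using h

end KummerLattice

end

open scoped TensorProduct

noncomputable section

namespace KummerLattice

/-! ### Sign and existence of the real spinor norm -/

section RealSpinorNorm

variable {V : Type*} [AddCommGroup V] [Module ℝ V] {B : LinearMap.BilinForm ℝ V}

/-! Both parts compare a lattice with a sublattice of finite index, the two differing by a single
glue vector. The congruence on `v*` says that an isometry respects the glue, so that it extends
(`exists_extension`).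

(1) As `div(h) = 1`, Eichler transvections and `-1` move `h` to `e + df` in the first hyperbolic
plane (`sameOrbit_of_divisor_one`). The complement of `e + df` is `ℤ(e - df) ⊕ 2U ⊕ ⟨-6⟩`, a copy of
`L_{2d}` with `v = e - df`. The lattice `M` is generated by `h^⊥ ⊕ ℤh` and `t = (h - v)/2d`. If `g`
fixes `h`, then `t - gt = (gv - v)/2d`; hence an isometry of `h^⊥`, extended by `h ↦ h`, preserves
`M` exactly when `gv - v ∈ 2d L_{2d}`. Since `div(v) = 2d`, this is the condition defining `Γ_{2d}`.

(2) Let `w` generate `⟨-2⟩`, so that `pw = ι(v)`. If `gv = v + 2p²l`, the extension must send `w` to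
`w + 2pι(l)`, which is integral and congruent to `w` modulo `2L_2`.

For the spinor norm, a word of reflections on the smaller space acts on the larger one as the
identity on the orthogonal complement, with the same norms (`RepresentsSpinorNorm.map`). So `O⁺`
passes upwards. Passing downwards also needs that every isometry is a word of reflections, and that
the sign of its spinor norm is independent of the word (`RepresentsSpinorNorm.mul_pos`): the sign
records the effect on orientations of maximal positive definite subspaces. -/

theorem reflectionIn_isometry (hB : ∀ x y, B x y = B y x) {w : V} (hw : B w w ≠ 0) (x y : V) :
    B (reflectionIn B w x) (reflectionIn B w y) = B x y := by
  simp only [reflectionIn_apply, map_sub, map_smul, LinearMap.sub_apply, LinearMap.smul_apply,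
    smul_eq_mul, hB w y]
  field_simp
  ring

theorem prod_reflectionIn_isometry (hB : ∀ x y, B x y = B y x) (ws : List V)
    (hws : ∀ w ∈ ws, B w w ≠ 0) (x y : V) :
    B ((ws.map (reflectionIn B)).prod x) ((ws.map (reflectionIn B)).prod y) = B x y := by
  induction ws with
  | nil => simp
  | cons a l ih =>
    simp only [List.map_cons, List.prod_cons, Module.End.mul_apply]
    rw [reflectionIn_isometry hB (hws a (by simp)), ih fun w hw => hws w (by simp [hw])]

/-- Composing with a reflection `σ_w` multiplies the orientation on a maximal positive definite
subspace by the sign of `-(w, w)`. -/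
theorem det_comp_reflectionIn {E : Type*} [AddCommGroup E] [Module ℝ E] [FiniteDimensional ℝ E]
    (hB : ∀ x y, B x y = B y x) (P : V →ₗ[ℝ] E) (hP : ∀ x, P x = 0 → x ≠ 0 → B x x < 0)
    (f : E →ₗ[ℝ] V) (hf : ∀ x, x ≠ 0 → 0 < B (f x) (f x)) {w : V} (hw : B w w ≠ 0) :
    ∃ k : ℝ, LinearMap.det (P ∘ₗ reflectionIn B w ∘ₗ f) = LinearMap.det (P ∘ₗ f) * k ∧
      0 < k * (-(B w w) / 2) := by
  have hinj : Function.Injective (P ∘ₗ f) := by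
    rw [← LinearMap.ker_eq_bot, LinearMap.ker_eq_bot']
    intro x hx
    by_contra hx0
    have h1 := hf x hx0
    have h2 : f x ≠ 0 := fun h => by simp [h] at h1
    exact absurd (hP (f x) hx h2) (not_lt.2 h1.le)
  obtain ⟨y, hy⟩ := (LinearMap.injective_iff_surjective.1 hinj) (P w)
  have hfl : ∀ v, B.flip w v = B v w := fun _ => rfl
  -- The reflection changes `f x` by a multiple of `w`, and `P w = P (f y)`; seen through `P`, it is
  -- therefore a transvection of `E` in the direction `y`.
  have hcomp : P ∘ₗ reflectionIn B w ∘ₗ f =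
      (P ∘ₗ f) ∘ₗ LinearMap.transvection (-(2 / B w w) • (B.flip w ∘ₗ f)) y := by
    ext x
    have hy' : P (f y) = P w := hy
    simp only [LinearMap.comp_apply, reflectionIn_apply, LinearMap.transvection.apply, map_add,
      map_sub, map_smul, hy', LinearMap.smul_apply, hfl, smul_eq_mul]
    rw [sub_eq_add_neg, ← neg_smul]
    congr 2
    ring
  refine ⟨1 + (-(2 / B w w) • (B.flip w ∘ₗ f)) y, ?_, ?_⟩
  · rw [hcomp, LinearMap.det_comp, LinearMap.transvection.det]
  · simp only [LinearMap.smul_apply, LinearMap.comp_apply, hfl, smul_eq_mul]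
    -- This splits `w` into `f y`, in a positive definite space, and `w - f y`, in the negative
    -- definite kernel of `P`.
    have e : (1 + -(2 / B w w) * B (f y) w) * (-(B w w) / 2) =
        (B (f y) (f y) - B (w - f y) (w - f y)) / 2 := by
      simp only [map_sub, LinearMap.sub_apply, hB w (f y)]
      field_simp
      ring
    rw [e]
    have h1 : 0 ≤ B (f y) (f y) := by
      by_cases h : y = 0
      · simp [h]
      · exact (hf y h).le
    by_cases h : w - f y = 0
    · have : w = f y := sub_eq_zero.1 h
      rw [h, ← this]
      rw [← this] at h1
      have := lt_of_le_of_ne h1 hw.symm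
      simpa using this
    · have h2 := hP (w - f y) (by
        have hy' : P (f y) = P w := hy
        rw [map_sub, hy', sub_self]) h
      linarith

/-- The reflections already applied preserve the form, so their composite with `f` is again positive
definite and the one-reflection case iterates. The determinant on the left depends only on the
product, not on the word. -/
theorem det_comp_prod_reflectionIn {E : Type*} [AddCommGroup E] [Module ℝ E]
    [FiniteDimensional ℝ E] (hB : ∀ x y, B x y = B y x) (P : V →ₗ[ℝ] E)
    (hP : ∀ x, P x = 0 → x ≠ 0 → B x x < 0)
    (f : E →ₗ[ℝ] V) (hf : ∀ x, x ≠ 0 → 0 < B (f x) (f x)) (ws : List V)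
    (hws : ∀ w ∈ ws, B w w ≠ 0) :
    ∃ k : ℝ, LinearMap.det (P ∘ₗ (ws.map (reflectionIn B)).prod ∘ₗ f) =
      LinearMap.det (P ∘ₗ f) * k ∧ 0 < k * (ws.map fun w => -(B w w) / 2).prod := by
  induction ws with
  | nil => exact ⟨1, by simp [Module.End.one_eq_id], by simp⟩
  | cons a l ih =>
    obtain ⟨k, hk, hk'⟩ := ih fun w hw => hws w (by simp [hw])
    obtain ⟨m, hm, hm'⟩ := det_comp_reflectionIn hB P hP
      ((l.map (reflectionIn B)).prod ∘ₗ f) (fun x hx => by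
        simp only [LinearMap.comp_apply]
        rw [prod_reflectionIn_isometry hB l fun w hw => hws w (by simp [hw])]
        exact hf x hx) (hws a (by simp))
    refine ⟨k * m, ?_, ?_⟩
    · simp only [List.map_cons, List.prod_cons, Module.End.mul_eq_comp, LinearMap.comp_assoc]
      rw [hm, hk, mul_assoc]
    · simp only [List.map_cons, List.prod_cons]
      have := mul_pos hk' hm'
      rwa [mul_mul_mul_comm, mul_comm (List.prod _)] at this

/-- A spanning family of pairwise orthogonal anisotropic vectors. -/
structure IsOrthogonalFrame {ι : Type*} (B : LinearMap.BilinForm ℝ V) (u : ι → V) : Prop where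
  orthogonal : ∀ i j, i ≠ j → B (u i) (u j) = 0
  anisotropic : ∀ i, B (u i) (u i) ≠ 0
  span_eq_top : Submodule.span ℝ (Set.range u) = ⊤

theorem IsOrthogonalFrame.sum_eq {ι : Type*} [Fintype ι] {u : ι → V} (hu : IsOrthogonalFrame B u)
    (x : V) : ∑ i, (B x (u i) / B (u i) (u i)) • u i = x := by
  classical
  have hx : x ∈ Submodule.span ℝ (Set.range u) := hu.span_eq_top ▸ Submodule.mem_top
  induction hx using Submodule.span_induction with
  | mem x hx =>
    obtain ⟨j, rfl⟩ := hx
    rw [Finset.sum_eq_single j]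
    · rw [div_self (hu.anisotropic j), one_smul]
    · intro i _ hij
      rw [hu.orthogonal j i hij.symm, zero_div, zero_smul]
    · simp
  | zero => simp
  | add x y _ _ hx hy =>
    simp only [map_add, LinearMap.add_apply, add_div, add_smul, Finset.sum_add_distrib, hx, hy]
  | smul a x _ hx =>
    simp only [map_smul, LinearMap.smul_apply, smul_eq_mul, mul_div_assoc, mul_smul,
      ← Finset.smul_sum, hx]

theorem IsOrthogonalFrame.apply_self {ι : Type*} [Fintype ι] {u : ι → V}
    (hu : IsOrthogonalFrame B u) (x : V) :
    B x x = ∑ i, B x (u i) ^ 2 / B (u i) (u i) := by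
  conv_lhs => enter [2]; rw [← hu.sum_eq x]
  simp only [map_sum, map_smul, smul_eq_mul]
  exact Finset.sum_congr rfl fun i _ => by ring

/-- Two representatives of the spinor norm of an isometry have the same sign. -/
theorem RepresentsSpinorNorm.mul_pos {ι : Type*} [Fintype ι] {u : ι → V}
    (hu : IsOrthogonalFrame B u) (hB : ∀ x y, B x y = B y x) {g : V ≃ₗ[ℝ] V} {c c' : ℝ}
    (h : RepresentsSpinorNorm B g c) (h' : RepresentsSpinorNorm B g c') : 0 < c * c' := by
  classical
  -- `f` parametrises the span of the positive frame vectors, and the kernel of `P` is its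
  -- orthogonal complement, which is negative definite.
  let P : V →ₗ[ℝ] ({i // 0 < B (u i) (u i)} → ℝ) := LinearMap.pi fun i => B.flip (u i)
  let f : ({i // 0 < B (u i) (u i)} → ℝ) →ₗ[ℝ] V :=
    Fintype.linearCombination ℝ fun i : {i // 0 < B (u i) (u i)} => u i
  have hP : ∀ x, P x = 0 → x ≠ 0 → B x x < 0 := by
    intro x hx hx0
    have hle : ∀ i, B x (u i) ^ 2 / B (u i) (u i) ≤ 0 := by
      intro i
      rcases lt_or_ge 0 (B (u i) (u i)) with hi | hi
      · have : B x (u i) = 0 := congrFun hx ⟨i, hi⟩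
        simp [this]
      · exact div_nonpos_of_nonneg_of_nonpos (sq_nonneg _) hi
    rw [hu.apply_self x]
    refine lt_of_le_of_ne (Finset.sum_nonpos fun i _ => hle i) fun h0 => hx0 ?_
    rw [Finset.sum_eq_zero_iff_of_nonpos fun i _ => hle i] at h0
    rw [← hu.sum_eq x]
    refine Finset.sum_eq_zero fun i hi => ?_
    have := h0 i hi
    rw [div_eq_zero_iff, or_iff_left (hu.anisotropic i)] at this
    rw [pow_eq_zero_iff two_ne_zero] at this
    rw [this, zero_div, zero_smul]
  have hfu : ∀ c (i : {i // 0 < B (u i) (u i)}), B (f c) (u i) = c i * B (u i) (u i) := by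
    intro c i
    simp only [f, Fintype.linearCombination_apply, map_sum, map_smul, LinearMap.sum_apply,
      LinearMap.smul_apply, smul_eq_mul]
    rw [Finset.sum_eq_single i]
    · intro j _ hj
      rw [hu.orthogonal j i fun e => hj (Subtype.ext e), mul_zero]
    · simp
  have hf : ∀ c, c ≠ 0 → 0 < B (f c) (f c) := by
    intro c hc
    have : B (f c) (f c) = ∑ i : {i // 0 < B (u i) (u i)}, c i ^ 2 * B (u i) (u i) := by
      conv_lhs => enter [2]; rw [show f c = ∑ i, c i • u i from Fintype.linearCombination_apply ..]
      simp only [map_sum, map_smul, smul_eq_mul, hfu]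
      exact Finset.sum_congr rfl fun i _ => by ring
    rw [this]
    obtain ⟨i, hi⟩ := Function.ne_iff.1 hc
    exact Finset.sum_pos' (fun j _ => mul_nonneg (sq_nonneg _) j.2.le)
      ⟨i, Finset.mem_univ _, _root_.mul_pos (sq_pos_of_ne_zero hi) i.2⟩
  obtain ⟨ws, h1, h2, rfl⟩ := h
  obtain ⟨ws', h1', h2', rfl⟩ := h'
  obtain ⟨k, hk, hk'⟩ := det_comp_prod_reflectionIn hB P hP f hf ws h1
  obtain ⟨m, hm, hm'⟩ := det_comp_prod_reflectionIn hB P hP f hf ws' h1'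
  rw [← h2] at hk
  rw [← h2', hk] at hm
  have hinj : LinearMap.det (P ∘ₗ f) ≠ 0 := by
    rw [← isUnit_iff_ne_zero, ← LinearMap.isUnit_iff_isUnit_det, LinearMap.isUnit_iff_ker_eq_bot,
      LinearMap.ker_eq_bot']
    intro x hx
    by_contra hx0
    have h1 := hf x hx0
    have h2 : f x ≠ 0 := fun h => by simp [h] at h1
    exact absurd (hP (f x) hx h2) (not_lt.2 h1.le)
  -- Both words give the same determinant, so their factors `k` and `m` agree.
  have := mul_left_cancel₀ hinj hm
  subst this
  have hk0 : 0 < k ^ 2 := sq_pos_of_ne_zero (by rintro rfl; simp at hk')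
  have := _root_.mul_pos hk' hm'
  rw [mul_mul_mul_comm, ← sq] at this
  exact (mul_pos_iff_of_pos_left hk0).1 this

/-- Every isometry is a product of reflections in anisotropic vectors. -/
theorem exists_representsSpinorNorm {ι : Type*} [Fintype ι] {u : ι → V}
    (hu : IsOrthogonalFrame B u) (hB : ∀ x y, B x y = B y x) {g : V ≃ₗ[ℝ] V}
    (hg : g ∈ orthogonalGroup B) : ∃ c, RepresentsSpinorNorm B g c := by
  classical
  have fix_of_orth : ∀ {w x : V}, B x w = 0 → reflectionIn B w x = x := by
    intro w x h
    rw [reflectionIn_apply, h]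
    simp
  -- Cartan–Dieudonné, one frame vector at a time: the word brings each `g (u i)` with `i ∈ s` back
  -- to `u i`.
  have key : ∀ s : Finset ι, ∃ ws : List V, (∀ w ∈ ws, B w w ≠ 0) ∧
      ∀ i ∈ s, (ws.map (reflectionIn B)).prod (g (u i)) = u i := by
    intro s
    induction s using Finset.induction_on with
    | empty => exact ⟨[], by simp, by simp⟩
    | insert a s ha ih =>
      obtain ⟨ws, h1, h2⟩ := ih
      set R := (ws.map (reflectionIn B)).prod with hR
      have hRB : ∀ x y, B (R x) (R y) = B x y := prod_reflectionIn_isometry hB ws h1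
      set x := R (g (u a)) with hx
      have hxx : B x x = B (u a) (u a) := by rw [hx, hRB, hg]
      have hxi : ∀ i ∈ s, B (u i) x = 0 := by
        intro i hi
        rw [← h2 i hi, hx, hRB, hg]
        exact hu.orthogonal _ _ fun e => ha (e ▸ hi)
      have hai : ∀ i ∈ s, B (u i) (u a) = 0 := fun i hi =>
        hu.orthogonal _ _ fun e => ha (e ▸ hi)
      -- The squares of `x - u a` and `x + u a` add up to `4 (u a, u a) ≠ 0`, so one of them is
      -- anisotropic. Both vectors are orthogonal to the frame vectors already treated.
      by_cases hm : B (x - u a) (x - u a) = 0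
      · have hp : B (x + u a) (x + u a) ≠ 0 := by
          have h4 := hu.anisotropic a
          have : B (x + u a) (x + u a) = 4 * B (u a) (u a) - B (x - u a) (x - u a) := by
            simp only [map_add, map_sub, LinearMap.add_apply, LinearMap.sub_apply, hxx]
            ring
          rw [this, hm]
          simpa using h4
        have e1 : reflectionIn B (x + u a) x = -u a := by
          have : 2 * B x (x + u a) / B (x + u a) (x + u a) = 1 := by
            rw [div_eq_one_iff_eq hp]
            simp only [map_add, LinearMap.add_apply, hxx, hB (u a) x]
            ring
          rw [reflectionIn_apply, this]
          simp
        have e2 : reflectionIn B (u a) (-u a) = u a := by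
          have h4 := hu.anisotropic a
          have : 2 * B (-u a) (u a) / B (u a) (u a) = -2 := by
            simp only [map_neg, LinearMap.neg_apply]
            field_simp
          rw [reflectionIn_apply, this, neg_smul, sub_neg_eq_add, two_smul]
          abel
        refine ⟨u a :: (x + u a) :: ws, ?_, ?_⟩
        · simp only [List.mem_cons, forall_eq_or_imp]
          exact ⟨hu.anisotropic a, hp, h1⟩
        · intro i hi
          simp only [List.map_cons, List.prod_cons, Module.End.mul_apply, ← hR]
          rcases Finset.mem_insert.1 hi with rfl | hi
          · rw [← hx, e1, e2]
          · rw [h2 i hi, fix_of_orth (w := x + u a), fix_of_orth (hai i hi)]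
            rw [map_add, hxi i hi, hai i hi, add_zero]
      · have e1 : reflectionIn B (x - u a) x = u a := by
          have : 2 * B x (x - u a) / B (x - u a) (x - u a) = 1 := by
            rw [div_eq_one_iff_eq hm]
            simp only [map_sub, LinearMap.sub_apply, hxx, hB (u a) x]
            ring
          rw [reflectionIn_apply, this]
          simp
        refine ⟨(x - u a) :: ws, ?_, ?_⟩
        · simp only [List.mem_cons, forall_eq_or_imp]
          exact ⟨hm, h1⟩
        · intro i hi
          simp only [List.map_cons, List.prod_cons, Module.End.mul_apply, ← hR]
          rcases Finset.mem_insert.1 hi with rfl | hi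
          · rw [← hx, e1]
          · rw [h2 i hi, fix_of_orth]
            rw [map_sub, hxi i hi, hai i hi, sub_zero]
  obtain ⟨ws, h1, h2⟩ := key Finset.univ
  suffices h : RepresentsSpinorNorm B g⁻¹ (ws.map fun w => -(B w w) / 2).prod by
    exact ⟨_, inv_inv g ▸ h.inv⟩
  refine ⟨ws, h1, ?_, rfl⟩
  have h3 : (ws.map (reflectionIn B)).prod ∘ₗ (g : V →ₗ[ℝ] V) = LinearMap.id := by
    refine LinearMap.ext_on_range hu.span_eq_top fun i => h2 i (Finset.mem_univ i)
  ext x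
  have h4 := LinearMap.congr_fun h3 (g⁻¹ x)
  have h5 : g (g⁻¹ x) = x := g.apply_symm_apply x
  simp only [LinearMap.comp_apply, LinearEquiv.coe_coe, h5, LinearMap.id_apply] at h4
  exact h4.symm

/-- Reflections extend along an isometric map as the identity on the orthogonal complement. -/
theorem RepresentsSpinorNorm.map {V' : Type*} [AddCommGroup V'] [Module ℝ V']
    {B' : LinearMap.BilinForm ℝ V'} (ψ : V' →ₗ[ℝ] V) (hψ : ∀ x y, B (ψ x) (ψ y) = B' x y)
    {g' : V' ≃ₗ[ℝ] V'} {g : V ≃ₗ[ℝ] V} (hg : ∀ x, g (ψ x) = ψ (g' x))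
    (hV : ∀ v, ∃ x k, v = ψ x + k ∧ (∀ y, B k (ψ y) = 0) ∧ g k = k) {c : ℝ}
    (h : RepresentsSpinorNorm B' g' c) : RepresentsSpinorNorm B g c := by
  obtain ⟨ws, h1, h2, rfl⟩ := h
  have hr : ∀ l : List V', (∀ x, ((l.map ψ).map (reflectionIn B)).prod (ψ x) =
      ψ ((l.map (reflectionIn B')).prod x)) ∧ ∀ k, (∀ y, B k (ψ y) = 0) →
      ((l.map ψ).map (reflectionIn B)).prod k = k := by
    intro l
    induction l with
    | nil => simp
    | cons a l ih =>
      simp only [List.map_cons, List.prod_cons, Module.End.mul_apply]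
      refine ⟨fun x => ?_, fun k hk => ?_⟩
      · rw [ih.1, reflectionIn_apply, reflectionIn_apply, hψ, hψ, map_sub, map_smul]
      · rw [ih.2 k hk, reflectionIn_apply, hk]
        simp
  refine ⟨ws.map ψ, ?_, ?_, ?_⟩
  · intro w hw
    obtain ⟨a, ha, rfl⟩ := List.mem_map.1 hw
    rw [hψ]
    exact h1 a ha
  · ext v
    obtain ⟨x, k, rfl, hk, hgk⟩ := hV v
    rw [map_add, map_add, (hr ws).1, (hr ws).2 k hk, ← h2]
    simp only [LinearEquiv.coe_coe, hg, hgk]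
  · simp [List.map_map, Function.comp_def, hψ]

end RealSpinorNorm

/-! ### `O⁺` of a lattice and of a sublattice -/

section RealExtension

variable {Λ Λ' : Type*} [AddCommGroup Λ] [AddCommGroup Λ']
  {B : LinearMap.BilinForm ℤ Λ} {B' : LinearMap.BilinForm ℤ Λ'}

theorem baseChange_real_symm (hB : ∀ x y, B x y = B y x) (x y : ℝ ⊗[ℤ] Λ) :
    LinearMap.BilinForm.baseChange ℝ B x y = LinearMap.BilinForm.baseChange ℝ B y x :=
  (LinearMap.BilinForm.IsSymm.baseChange ℝ ⟨hB⟩).eq x y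

theorem baseChange_real_isometric {i : Λ' →ₗ[ℤ] Λ} (hi : ∀ x y, B (i x) (i y) = B' x y)
    (x y : ℝ ⊗[ℤ] Λ') :
    LinearMap.BilinForm.baseChange ℝ B (i.baseChange ℝ x) (i.baseChange ℝ y) =
      LinearMap.BilinForm.baseChange ℝ B' x y := by
  induction x using TensorProduct.induction_on with
  | zero => simp
  | add a b ha hb => simp only [map_add, LinearMap.add_apply, ha, hb]
  | tmul a x =>
    induction y using TensorProduct.induction_on with
    | zero => simp
    | add a b ha hb => simp only [map_add, ha, hb]
    | tmul b y =>
      simp only [LinearMap.baseChange_tmul, LinearMap.BilinForm.baseChange_tmul, hi]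

theorem baseChange_mem_orthogonalGroup {g : Λ ≃ₗ[ℤ] Λ} (hg : g ∈ orthogonalGroup B) :
    g.baseChange ℤ ℝ Λ Λ ∈ orthogonalGroup (LinearMap.BilinForm.baseChange ℝ B) :=
  fun x y => baseChange_real_isometric (i := (g : Λ →ₗ[ℤ] Λ)) hg x y

/-- Membership in the spinor kernel only depends on the sign of a representative. -/
theorem mem_orthogonalGroupPlus_iff {g : Λ ≃ₗ[ℤ] Λ} :
    g ∈ orthogonalGroupPlus B ↔ g ∈ orthogonalGroup B ∧
      ∃ c, RepresentsSpinorNorm (LinearMap.BilinForm.baseChange ℝ B) (g.baseChange ℤ ℝ Λ Λ) c ∧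
        0 ≤ c :=
  ⟨fun ⟨h, _, c, hc, hs⟩ => ⟨h, c, hc, hs.nonneg⟩, fun ⟨h, c, hc, hs⟩ =>
    ⟨h, baseChange_mem_orthogonalGroup h, c, hc, ⟨√c, (Real.mul_self_sqrt hs).symm⟩⟩⟩

/-- Division by `N` over `ℝ` turns `hΛ` into the decomposition required by
`RepresentsSpinorNorm.map`. The complement `k` will be `0` for `L_{2p²}` in `L_2` and a multiple of
`h` for `h^⊥` in `M`. -/
theorem RepresentsSpinorNorm.baseChange_map {i : Λ' →ₗ[ℤ] Λ}
    (hi : ∀ x y, B (i x) (i y) = B' x y) {g : Λ ≃ₗ[ℤ] Λ} {g' : Λ' ≃ₗ[ℤ] Λ'}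
    (hg : ∀ x, g (i x) = i (g' x)) {N : ℤ} (hN : N ≠ 0)
    (hΛ : ∀ x, ∃ y k, N • x = i y + k ∧ (∀ z, B k (i z) = 0) ∧ g k = k) {c : ℝ}
    (h : RepresentsSpinorNorm (LinearMap.BilinForm.baseChange ℝ B') (g'.baseChange ℤ ℝ Λ' Λ') c) :
    RepresentsSpinorNorm (LinearMap.BilinForm.baseChange ℝ B) (g.baseChange ℤ ℝ Λ Λ) c := by
  refine h.map (i.baseChange ℝ) (baseChange_real_isometric hi) ?_ ?_
  · intro x
    induction x using TensorProduct.induction_on with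
    | zero => simp
    | add a b ha hb => simp only [map_add, ha, hb]
    | tmul a x =>
      rw [LinearMap.baseChange_tmul, LinearEquiv.baseChange_tmul, LinearEquiv.baseChange_tmul,
        LinearMap.baseChange_tmul, hg]
  · intro v
    induction v using TensorProduct.induction_on with
    | zero => exact ⟨0, 0, by simp, by simp, by simp⟩
    | add a b ha hb =>
      obtain ⟨x, k, rfl, h1, h2⟩ := ha
      obtain ⟨y, l, rfl, h3, h4⟩ := hb
      refine ⟨x + y, k + l, by rw [map_add]; abel, fun z => ?_, by rw [map_add, h2, h4]⟩
      rw [map_add, LinearMap.add_apply, h1, h3, add_zero]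
    | tmul a x =>
      obtain ⟨y, k, hx, hk, hgk⟩ := hΛ x
      refine ⟨(a / N) ⊗ₜ y, (a / N) ⊗ₜ k, ?_, ?_, ?_⟩
      · rw [LinearMap.baseChange_tmul, ← TensorProduct.tmul_add, ← hx, TensorProduct.tmul_smul,
          TensorProduct.smul_tmul', zsmul_eq_mul, mul_div_cancel₀]
        exact_mod_cast hN
      · intro z
        induction z using TensorProduct.induction_on with
        | zero => simp
        | add a b ha hb => simp only [map_add, ha, hb, add_zero]
        | tmul b z =>
          rw [LinearMap.baseChange_tmul, LinearMap.BilinForm.baseChange_tmul, hk, zero_smul]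
      · rw [LinearEquiv.baseChange_tmul, hgk]

/-- The lattice contains an orthogonal sublattice of finite index. -/
def HasOrthogonalFrame (B : LinearMap.BilinForm ℤ Λ) : Prop :=
  ∃ (ι : Type) (_ : Fintype ι) (u : ι → Λ), (∀ i j, i ≠ j → B (u i) (u j) = 0) ∧
    (∀ i, B (u i) (u i) ≠ 0) ∧
    ∃ N : ℤ, N ≠ 0 ∧ ∀ x, N • x ∈ Submodule.span ℤ (Set.range u)

theorem HasOrthogonalFrame.baseChange (h : HasOrthogonalFrame B) :
    ∃ (ι : Type) (_ : Fintype ι) (u : ι → ℝ ⊗[ℤ] Λ),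
      IsOrthogonalFrame (LinearMap.BilinForm.baseChange ℝ B) u := by
  obtain ⟨ι, hι, u, h1, h2, N, hN, h3⟩ := h
  refine ⟨ι, hι, fun i => 1 ⊗ₜ u i, ⟨fun i j hij => ?_, fun i => ?_, ?_⟩⟩
  · rw [LinearMap.BilinForm.baseChange_tmul, h1 i j hij, zero_smul]
  · rw [LinearMap.BilinForm.baseChange_tmul]
    simpa using h2 i
  · have key : ∀ y ∈ Submodule.span ℤ (Set.range u), (1 : ℝ) ⊗ₜ[ℤ] y ∈
        Submodule.span ℝ (Set.range fun i => (1 : ℝ) ⊗ₜ[ℤ] u i) := by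
      intro y hy
      induction hy using Submodule.span_induction with
      | mem x hx =>
        obtain ⟨i, rfl⟩ := hx
        exact Submodule.subset_span ⟨i, rfl⟩
      | zero => simp
      | add x y _ _ hx hy =>
        rw [TensorProduct.tmul_add]
        exact add_mem hx hy
      | smul a x _ hx =>
        rw [TensorProduct.tmul_smul]
        exact zsmul_mem hx a
    rw [eq_top_iff]
    intro v _
    induction v using TensorProduct.induction_on with
    | zero => exact zero_mem _
    | add a b ha hb => exact add_mem (ha trivial) (hb trivial)
    | tmul a x =>
      have e : a ⊗ₜ[ℤ] x = (a / N) • ((1 : ℝ) ⊗ₜ[ℤ] (N • x)) := by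
        have hN' : (N : ℝ) ≠ 0 := by exact_mod_cast hN
        rw [TensorProduct.tmul_smul, TensorProduct.smul_tmul', TensorProduct.smul_tmul',
          smul_eq_mul, zsmul_eq_mul, mul_one, div_mul_cancel₀ _ hN']
      rw [e]
      exact Submodule.smul_mem _ _ (key _ (h3 x))

theorem HasOrthogonalFrame.oplus (h : HasOrthogonalFrame B) (h' : HasOrthogonalFrame B') :
    HasOrthogonalFrame (oplus B B') := by
  obtain ⟨ι, _, u, h1, h2, N, hN, h3⟩ := h
  obtain ⟨ι', _, u', h1', h2', N', hN', h3'⟩ := h'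
  refine ⟨ι ⊕ ι', inferInstance, Sum.elim (fun i => (u i, 0)) (fun i => (0, u' i)), ?_, ?_,
    N * N', mul_ne_zero hN hN', ?_⟩
  · rintro (i | i) (j | j) hij <;> simp only [oplus_apply, Sum.elim_inl, Sum.elim_inr]
    · simp [h1 i j fun e => hij (e ▸ rfl)]
    · simp
    · simp
    · simp [h1' i j fun e => hij (e ▸ rfl)]
  · rintro (i | i) <;> simp [oplus_apply, h2, h2']
  · rintro ⟨x, y⟩
    have hl : ∀ x ∈ Submodule.span ℤ (Set.range u), ((x, 0) : Λ × Λ') ∈ Submodule.span ℤ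
        (Set.range (Sum.elim (fun i => ((u i, 0) : Λ × Λ')) (fun i => (0, u' i)))) := by
      intro x hx
      have := Submodule.mem_map_of_mem (f := LinearMap.inl ℤ Λ Λ') hx
      rw [Submodule.map_span] at this
      refine Submodule.span_mono ?_ this
      rintro _ ⟨_, ⟨i, rfl⟩, rfl⟩
      exact ⟨Sum.inl i, rfl⟩
    have hr : ∀ x ∈ Submodule.span ℤ (Set.range u'), ((0, x) : Λ × Λ') ∈ Submodule.span ℤ
        (Set.range (Sum.elim (fun i => ((u i, 0) : Λ × Λ')) (fun i => (0, u' i)))) := by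
      intro x hx
      have := Submodule.mem_map_of_mem (f := LinearMap.inr ℤ Λ Λ') hx
      rw [Submodule.map_span] at this
      refine Submodule.span_mono ?_ this
      rintro _ ⟨_, ⟨i, rfl⟩, rfl⟩
      exact ⟨Sum.inr i, rfl⟩
    have e : (N * N') • ((x, y) : Λ × Λ') = N' • (N • x, 0) + N • (0, N' • y) := by
      simp [mul_smul, smul_comm N N']
    rw [e]
    exact add_mem (Submodule.smul_mem _ _ (hl _ (h3 x))) (Submodule.smul_mem _ _ (hr _ (h3' y)))

theorem hasOrthogonalFrame_rankOne {n : ℤ} (hn : n ≠ 0) : HasOrthogonalFrame (rankOne n) :=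
  ⟨Unit, inferInstance, fun _ => 1, fun i j h => absurd (Subsingleton.elim i j) h,
    fun _ => by simpa [rankOne_apply] using hn, 1, one_ne_zero, fun x => by simp⟩

theorem hasOrthogonalFrame_hypPlane : HasOrthogonalFrame hypPlane := by
  refine ⟨Fin 2, inferInstance, ![(1, 1), (1, -1)], ?_, ?_, 2, two_ne_zero, ?_⟩
  · intro i j hij
    fin_cases i <;> fin_cases j <;> simp_all [hypPlane_apply]
  · intro i
    fin_cases i <;> simp [hypPlane_apply]
  · rintro ⟨x, y⟩
    have e : (2 : ℤ) • ((x, y) : ℤ × ℤ) = (x + y) • (1, 1) + (x - y) • (1, -1) := by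
      ext <;> simp <;> ring
    rw [e]
    exact add_mem (Submodule.smul_mem _ _ (Submodule.subset_span ⟨0, rfl⟩))
      (Submodule.smul_mem _ _ (Submodule.subset_span ⟨1, rfl⟩))

theorem hasOrthogonalFrame_formM : HasOrthogonalFrame formM :=
  hasOrthogonalFrame_hypPlane.oplus (hasOrthogonalFrame_hypPlane.oplus
    (hasOrthogonalFrame_hypPlane.oplus (hasOrthogonalFrame_rankOne (by norm_num))))

theorem hasOrthogonalFrame_formL {d : ℕ} (hd : d ≠ 0) : HasOrthogonalFrame (formL d) :=
  hasOrthogonalFrame_hypPlane.oplus (hasOrthogonalFrame_hypPlane.oplus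
    ((hasOrthogonalFrame_rankOne (by simpa using hd)).oplus
      (hasOrthogonalFrame_rankOne (by norm_num))))

theorem oplus_symm (hB : ∀ x y, B x y = B y x) (hB' : ∀ x y, B' x y = B' y x) (x y : Λ × Λ') :
    oplus B B' x y = oplus B B' y x := by
  rw [oplus_apply, oplus_apply, hB, hB']

theorem hypPlane_symm (x y : ℤ × ℤ) : hypPlane x y = hypPlane y x := by
  rw [hypPlane_apply, hypPlane_apply]
  ring

theorem rankOne_symm (n x y : ℤ) : rankOne n x y = rankOne n y x := by
  rw [rankOne_apply, rankOne_apply]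
  ring

theorem formM_symm : ∀ x y, formM x y = formM y x :=
  oplus_symm hypPlane_symm (oplus_symm hypPlane_symm (oplus_symm hypPlane_symm (rankOne_symm _)))

theorem formL_symm (d : ℕ) : ∀ x y, formL d x y = formL d y x :=
  oplus_symm hypPlane_symm (oplus_symm hypPlane_symm (oplus_symm (rankOne_symm _) (rankOne_symm _)))

/-- `O⁺` passes from a sublattice to an overlattice. -/
theorem mem_orthogonalGroupPlus_of_restrict {i : Λ' →ₗ[ℤ] Λ}
    (hi : ∀ x y, B (i x) (i y) = B' x y) {g : Λ ≃ₗ[ℤ] Λ} {g' : Λ' ≃ₗ[ℤ] Λ'}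
    (hg : ∀ x, g (i x) = i (g' x)) {N : ℤ} (hN : N ≠ 0)
    (hΛ : ∀ x, ∃ y k, N • x = i y + k ∧ (∀ z, B k (i z) = 0) ∧ g k = k)
    (hgB : g ∈ orthogonalGroup B) (h : g' ∈ orthogonalGroupPlus B') :
    g ∈ orthogonalGroupPlus B := by
  obtain ⟨-, c, hc, h0⟩ := mem_orthogonalGroupPlus_iff.1 h
  exact mem_orthogonalGroupPlus_iff.2 ⟨hgB, c, hc.baseChange_map hi hg hN hΛ, h0⟩

/-- `O⁺` passes from a lattice to a sublattice. -/
theorem restrict_mem_orthogonalGroupPlus {i : Λ' →ₗ[ℤ] Λ}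
    (hi : ∀ x y, B (i x) (i y) = B' x y) {g : Λ ≃ₗ[ℤ] Λ} {g' : Λ' ≃ₗ[ℤ] Λ'}
    (hg : ∀ x, g (i x) = i (g' x)) {N : ℤ} (hN : N ≠ 0)
    (hΛ : ∀ x, ∃ y k, N • x = i y + k ∧ (∀ z, B k (i z) = 0) ∧ g k = k)
    (hB : ∀ x y, B x y = B y x) (hB' : ∀ x y, B' x y = B' y x)
    (hf : HasOrthogonalFrame B) (hf' : HasOrthogonalFrame B')
    (hg' : g' ∈ orthogonalGroup B') (h : g ∈ orthogonalGroupPlus B) :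
    g' ∈ orthogonalGroupPlus B' := by
  obtain ⟨ι, _, u, hu⟩ := hf.baseChange
  obtain ⟨ι', _, u', hu'⟩ := hf'.baseChange
  obtain ⟨-, c, hc, h0⟩ := mem_orthogonalGroupPlus_iff.1 h
  obtain ⟨c', hc'⟩ := exists_representsSpinorNorm hu' (baseChange_real_symm hB')
    (baseChange_mem_orthogonalGroup hg')
  refine mem_orthogonalGroupPlus_iff.2 ⟨hg', c', hc', ?_⟩
  -- The representative `c'` for `g'` also represents `g`, hence has the sign of `c`.
  have := hc.mul_pos hu (baseChange_real_symm hB) (hc'.baseChange_map hi hg hN hΛ)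
  exact (pos_of_mul_pos_right this h0).le

end RealExtension

/-! ### Extending automorphisms from a sublattice of finite index -/

section Extension

variable {Λ Λ' : Type*} [AddCommGroup Λ] [AddCommGroup Λ']
  {B : LinearMap.BilinForm ℤ Λ} {B' : LinearMap.BilinForm ℤ Λ'}

theorem exists_linearMap_smul_eq [Module.IsTorsionFree ℤ Λ] {n : ℤ} (hn : n ≠ 0) (f : Λ →ₗ[ℤ] Λ)
    (hf : ∀ m, ∃ y, n • y = f m) : ∃ g : Λ →ₗ[ℤ] Λ, ∀ m, n • g m = f m := by
  choose g hg using hf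
  exact ⟨{ toFun := g
           map_add' := fun x y => smul_right_injective Λ hn (by simp [hg])
           map_smul' := fun a x => smul_right_injective Λ hn (by
            simp only [RingHom.id_apply, hg, map_smul, smul_comm n a]) }, hg⟩

/-- Extension of an automorphism of a subgroup of finite index. -/
theorem exists_extension [Module.IsTorsionFree ℤ Λ] {n : ℤ} (hn : n ≠ 0) {i : Λ' →ₗ[ℤ] Λ} (hi : Function.Injective i)
    {π : Λ →ₗ[ℤ] Λ'} (hπ : ∀ m, i (π m) = n • m) (g' : Λ' ≃ₗ[ℤ] Λ')
    (h : ∀ m, ∃ y, n • y = i (g' (π m))) (h' : ∀ m, ∃ y, n • y = i (g'⁻¹ (π m))) :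
    ∃ g : Λ ≃ₗ[ℤ] Λ, ∀ x, g (i x) = i (g' x) := by
  -- The extension is `n⁻¹ i g' π`; `h` makes it integral, and `h'` does the same for its inverse.
  obtain ⟨a, ha⟩ := exists_linearMap_smul_eq hn (i ∘ₗ (g' : Λ' →ₗ[ℤ] Λ') ∘ₗ π) h
  obtain ⟨b, hb⟩ := exists_linearMap_smul_eq hn (i ∘ₗ ((g'⁻¹ : Λ' ≃ₗ[ℤ] Λ') : Λ' →ₗ[ℤ] Λ') ∘ₗ π) h'
  have hπi : ∀ x, π (i x) = n • x := fun x => hi (by rw [hπ, map_smul])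
  have ai : ∀ x, a (i x) = i (g' x) := fun x =>
    smul_right_injective Λ hn (by simp [ha, hπi])
  have bi : ∀ x, b (i x) = i (g'⁻¹ x) := fun x =>
    smul_right_injective Λ hn (by simp [hb, hπi])
  have e : ∀ x, g' (g'⁻¹ x) = x := g'.apply_symm_apply
  have e' : ∀ x, g'⁻¹ (g' x) = x := g'.symm_apply_apply
  refine ⟨LinearEquiv.ofLinearMap a b ?_ ?_, ai⟩
  · refine LinearMap.ext fun m => smul_right_injective Λ hn ?_
    change n • a (b m) = n • m
    rw [← map_smul, hb]
    simp only [LinearMap.comp_apply, LinearEquiv.coe_coe, ai, e, hπ]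
  · refine LinearMap.ext fun m => smul_right_injective Λ hn ?_
    change n • b (a m) = n • m
    rw [← map_smul, ha]
    simp only [LinearMap.comp_apply, LinearEquiv.coe_coe, bi, e', hπ]

theorem extension_isometry {n : ℤ} (hn : n ≠ 0) {i : Λ' →ₗ[ℤ] Λ}
    (hi : ∀ x y, B (i x) (i y) = B' x y) {π : Λ →ₗ[ℤ] Λ'} (hπ : ∀ m, i (π m) = n • m)
    {g : Λ ≃ₗ[ℤ] Λ} {g' : Λ' ≃ₗ[ℤ] Λ'} (hg : ∀ x, g (i x) = i (g' x))
    (hg' : g' ∈ orthogonalGroup B') : g ∈ orthogonalGroup B := by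
  intro x y
  have h1 : B (g (n • x)) (g (n • y)) = B (n • x) (n • y) := by
    rw [← hπ, ← hπ, hg, hg, hi, hi, hg']
  simp only [map_smul, LinearMap.smul_apply, smul_eq_mul] at h1
  exact mul_left_cancel₀ hn (mul_left_cancel₀ hn h1)

end Extension

/-! ### Eichler transvections and vectors of divisor one -/

section Eichler

variable {Λ : Type*} [AddCommGroup Λ] {B : LinearMap.BilinForm ℤ Λ}

/-- The Eichler transvection attached to an isotropic vector `e` and `a ∈ e^⊥` with
`(a, a) = 2q`. -/
def eichlerMap (B : LinearMap.BilinForm ℤ Λ) (e a : Λ) (q : ℤ) : Λ →ₗ[ℤ] Λ :=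
  LinearMap.id + (B e).smulRight a - (B a).smulRight e - (q • B e).smulRight e

theorem eichlerMap_apply (e a : Λ) (q : ℤ) (x : Λ) :
    eichlerMap B e a q x = x + B e x • a - B a x • e - (q * B e x) • e := rfl

/-- Transvections along a fixed `e` compose by adding the vectors `a`, so `-a` gives the inverse. -/
theorem eichlerMap_neg_apply {e a : Λ} {q : ℤ} (hB : ∀ x y, B x y = B y x) (he : B e e = 0)
    (hea : B e a = 0) (ha : B a a = 2 * q) (x : Λ) :
    eichlerMap B e a q (eichlerMap B e (-a) q x) = x := by
  have hae : B a e = 0 := hB a e ▸ hea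
  simp only [eichlerMap_apply, map_add, map_sub, map_smul, map_neg, LinearMap.neg_apply, he, hea,
    ha, hae]
  module

/-- `x` and `y` are in the same orbit of `O(Λ)`. -/
def SameOrbit (B : LinearMap.BilinForm ℤ Λ) (x y : Λ) : Prop :=
  ∃ T ∈ orthogonalGroup B, T x = y

theorem SameOrbit.trans {x y z : Λ} : SameOrbit B x y → SameOrbit B y z → SameOrbit B x z := by
  rintro ⟨S, hS, rfl⟩ ⟨T, hT, rfl⟩
  exact ⟨T * S, mul_mem hT hS, rfl⟩

theorem SameOrbit.neg (x : Λ) : SameOrbit B x (-x) :=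
  ⟨LinearEquiv.neg ℤ, fun x y => by simp, rfl⟩

theorem SameOrbit.eichlerMap (hB : ∀ x y, B x y = B y x) {e a : Λ} {q : ℤ} (he : B e e = 0)
    (hea : B e a = 0) (ha : B a a = 2 * q) (x : Λ) : SameOrbit B x (eichlerMap B e a q x) := by
  refine ⟨LinearEquiv.ofLinearMap (KummerLattice.eichlerMap B e a q)
    (KummerLattice.eichlerMap B e (-a) q)
    (LinearMap.ext fun x => eichlerMap_neg_apply hB he hea ha x) (LinearMap.ext fun x => ?_),
    fun x y => ?_, rfl⟩
  · have := eichlerMap_neg_apply (B := B) (e := e) (a := -a) (q := q) hB he (by simpa using hea)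
      (by simpa using ha) x
    rwa [neg_neg] at this
  · change B (KummerLattice.eichlerMap B e a q x) (KummerLattice.eichlerMap B e a q y) = B x y
    have hae : B a e = 0 := hB a e ▸ hea
    simp only [eichlerMap_apply, map_add, map_sub, map_smul, LinearMap.add_apply,
      LinearMap.sub_apply, LinearMap.smul_apply, he, hea, ha, hae, smul_eq_mul, hB x a, hB x e]
    ring

/-- A special case of the Eichler criterion: in an even lattice with two orthogonal hyperbolic
planes, a vector of square `2d` and divisor one is equivalent to `e₁ + d f₁`. -/
theorem sameOrbit_of_divisor_one (hB : ∀ x y, B x y = B y x) (heven : ∀ x, ∃ q, B x x = 2 * q)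
    {e₁ f₁ e₂ f₂ : Λ} (h₁ : B e₁ e₁ = 0) (h₂ : B f₁ f₁ = 0) (h₃ : B e₁ f₁ = 1)
    (h₄ : B e₂ e₂ = 0) (h₅ : B f₂ f₂ = 0) (h₆ : B e₂ f₂ = 1) (h₇ : B e₁ e₂ = 0)
    (h₈ : B e₁ f₂ = 0) (h₉ : B f₁ e₂ = 0) (h₁₀ : B f₁ f₂ = 0) {h : Λ} {d : ℤ}
    (hd : B h h = 2 * d) (hdiv : ∃ y, B h y = 1) : SameOrbit B h (e₁ + d • f₁) := by
  have h₃' := hB e₁ f₁ ▸ h₃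
  have h₆' := hB e₂ f₂ ▸ h₆
  have h₇' := hB e₁ e₂ ▸ h₇
  have h₈' := hB e₁ f₂ ▸ h₈
  have h₉' := hB f₁ e₂ ▸ h₉
  have h₁₀' := hB f₁ f₂ ▸ h₁₀
  -- Splitting off the second hyperbolic plane leaves `a` orthogonal to `e₂`, hence admissible for a
  -- transvection along `e₂`.
  have hdec : ∀ y, ∃ a b c, y = a + b • e₂ + c • f₂ ∧ B e₂ a = 0 ∧ B f₂ a = 0 := fun y =>
    ⟨y - B f₂ y • e₂ - B e₂ y • f₂, B f₂ y, B e₂ y, by abel,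
      by simp [h₄, h₆], by simp [h₅, h₆']⟩
  -- A nonzero pairing with `e₂` or `f₂` is carried to `f₁` by a transvection with vector `e₁`. If
  -- both pairings vanish, divisor one gives `a` with `(a, h) = 1`, and a transvection along `e₂`
  -- makes the pairing with `f₂` equal to `-1`.
  have hne : ∃ x, SameOrbit B h x ∧ B f₁ x ≠ 0 := by
    have step : ∀ x, SameOrbit B h x → B e₂ x ≠ 0 ∨ B f₂ x ≠ 0 →
        ∃ x, SameOrbit B h x ∧ B f₁ x ≠ 0 := by
      intro x hx hx'
      by_cases h0 : B f₁ x = 0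
      · rcases hx' with hx' | hx'
        · refine ⟨_, hx.trans (.eichlerMap hB (e := e₂) (a := e₁) (q := 0) h₄ h₇' (by simp [h₁]) x),
            ?_⟩
          simpa [eichlerMap_apply, h0, h₉, h₃'] using hx'
        · refine ⟨_, hx.trans (.eichlerMap hB (e := f₂) (a := e₁) (q := 0) h₅ h₈' (by simp [h₁]) x),
            ?_⟩
          simpa [eichlerMap_apply, h0, h₁₀, h₃'] using hx'
      · exact ⟨x, hx, h0⟩
    have hrefl : SameOrbit B h h := ⟨1, one_mem _, rfl⟩
    by_cases h0 : B e₂ h = 0 ∧ B f₂ h = 0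
    · obtain ⟨y, hy⟩ := hdiv
      obtain ⟨a, b, c, rfl, ha, ha'⟩ := hdec y
      obtain ⟨q, hq⟩ := heven a
      refine step _ (.eichlerMap hB (e := e₂) (a := a) h₄ ha hq h) (Or.inr ?_)
      have : B a h = 1 := by simpa [hB h, h0.1, h0.2] using hy
      simp [eichlerMap_apply, h0.1, h0.2, h₆', this]
    · exact step h hrefl (by tauto)
  have hpos : ∃ m : ℕ, 0 < m ∧ ∃ x, SameOrbit B h x ∧ B f₁ x = m := by
    obtain ⟨x, hx, hx'⟩ := hne
    refine ⟨(B f₁ x).natAbs, by omega, ?_⟩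
    rcases Int.natAbs_eq (B f₁ x) with e | e
    · exact ⟨x, hx, e⟩
    · exact ⟨-x, hx.trans (.neg x), by rw [map_neg]; omega⟩
  classical
  obtain ⟨hm, -⟩ := Nat.find_spec hpos
  have hmin : ∀ x, SameOrbit B h x → 0 < B f₁ x → (Nat.find hpos : ℤ) ≤ B f₁ x := by
    intro x hx hx'
    have := Nat.find_min' hpos (m := (B f₁ x).toNat) ⟨by omega, x, hx, by omega⟩
    omega
  obtain ⟨x, hx, hxm⟩ := (Nat.find_spec hpos).2
  generalize Nat.find hpos = m at hm hmin hxm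
  -- Euclidean division against the minimal `m`: a transvection along `f₁` replaces `(e, x)` by its
  -- remainder `r` modulo `m`; if `r ≠ 0`, a transvection along `e` then lowers `(f₁, x)` to `m -
  -- r`.
  have hdvd : ∀ e e', B e e = 0 → B e' e' = 0 → B e e' = 1 → B f₁ e = 0 → B f₁ e' = 0 →
      B e₁ e = 0 → ∀ x, SameOrbit B h x → B f₁ x = m → (m : ℤ) ∣ B e x := by
    intro e e' he he' hee hfe hfe' hee₁ x hx hxm
    have hm' : (m : ℤ) ≠ 0 := by omega
    by_contra hnd
    have hr : 0 < B e x % m := lt_of_le_of_ne (Int.emod_nonneg _ hm')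
      fun h0 => hnd (Int.dvd_of_emod_eq_zero h0.symm)
    have hr' : B e x % m < m := Int.emod_lt_of_pos _ (by omega)
    have hx₂ := hx.trans (.eichlerMap hB (e := f₁) (a := (-(B e x / m)) • e') (q := 0) h₂
      (by simp [hfe']) (by simp [he']) x)
    set y := eichlerMap B f₁ ((-(B e x / m)) • e') 0 x with hy
    have hy₁ : B f₁ y = m := by simp [hy, eichlerMap_apply, hxm, h₂, hfe']
    have hy₂ : B e y = B e x % m := by
      simp only [hy, eichlerMap_apply, hxm, map_sub, map_add, map_smul, hB e f₁, hfe, hee,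
        smul_eq_mul]
      rw [Int.emod_def]
      ring
    have hx₃ := hx₂.trans (.eichlerMap hB (e := e) (a := -e₁) (q := 0) he
      (by simp [hB e e₁, hee₁]) (by simp [h₁]) y)
    have hz : B f₁ (eichlerMap B e (-e₁) 0 y) = m - B e x % m := by
      simp only [eichlerMap_apply, hy₁, hy₂, map_sub, map_add, map_smul, map_neg, h₃', hfe,
        smul_eq_mul]
      ring
    have := hmin _ hx₃ (by omega)
    omega
  have hd₁ : ∀ x, SameOrbit B h x → B f₁ x = m → (m : ℤ) ∣ B e₂ x :=
    hdvd e₂ f₂ h₄ h₅ h₆ h₉ h₁₀ h₇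
  have hd₂ : ∀ x, SameOrbit B h x → B f₁ x = m → (m : ℤ) ∣ B f₂ x :=
    hdvd f₂ e₂ h₅ h₄ h₆' h₁₀ h₉ h₈
  obtain ⟨x, hx, hxm, hxe, hxf⟩ :
      ∃ x, SameOrbit B h x ∧ B f₁ x = m ∧ B e₂ x = 0 ∧ B f₂ x = 0 := by
    obtain ⟨k, hk⟩ := hd₁ x hx hxm
    obtain ⟨l, hl⟩ := hd₂ x hx hxm
    refine ⟨_, hx.trans (.eichlerMap hB (e := f₁) (a := -l • e₂ - k • f₂) (q := k * l) h₂
      (by simp [h₉, h₁₀]) (by simp [h₄, h₅, h₆, h₆']; ring) x), ?_, ?_, ?_⟩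
    · simp [eichlerMap_apply, hxm, h₂, h₉, h₁₀]
    · simp [eichlerMap_apply, hxm, hk, h₄, h₆, h₉']
    · simp [eichlerMap_apply, hxm, hl, h₅, h₆', h₁₀']
  -- With `x` orthogonal to the second plane, a transvection along `e₂` moves `(a, x)` into the
  -- pairing with `f₂` and keeps `(f₁, x) = m`, so `hd₂` applies.
  have hall : ∀ y, (m : ℤ) ∣ B x y := by
    intro y
    obtain ⟨a, b, c, rfl, ha, ha'⟩ := hdec y
    obtain ⟨q, hq⟩ := heven a
    have hz := hd₂ _ (hx.trans (.eichlerMap hB (e := e₂) (a := a) h₄ ha hq x))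
      (by simp [eichlerMap_apply, hxe, hxm, h₉])
    simp only [eichlerMap_apply, hxe, map_sub, map_add, map_smul, hxf, h₆', smul_eq_mul] at hz
    simpa [hB x, hxe, hxf] using hz
  have hm1 : m = 1 := by
    obtain ⟨y, hy⟩ := hdiv
    obtain ⟨T, hT, rfl⟩ := hx
    have := hall (T y)
    rw [hT, hy] at this
    exact_mod_cast Int.eq_one_of_dvd_one (by omega) this
  rw [hm1, Nat.cast_one] at hxm
  -- The part of `x` orthogonal to the first plane is removed by one transvection along `f₁`,
  -- because `(f₁, x) = 1`.
  obtain ⟨q, hq⟩ := heven (x - e₁ - B e₁ x • f₁)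
  have hx₂ := hx.trans (.eichlerMap hB (e := f₁) (a := -(x - e₁ - B e₁ x • f₁)) (q := q) h₂
    (by simp [hxm, h₂, h₃'])
    (by rw [map_neg, map_neg, LinearMap.neg_apply, neg_neg, hq]) x)
  obtain ⟨r, hr⟩ : ∃ r : ℤ, eichlerMap B f₁ (-(x - e₁ - B e₁ x • f₁)) q x = e₁ + r • f₁ := by
    refine ⟨B e₁ x - B (-(x - e₁ - B e₁ x • f₁)) x - q, ?_⟩
    rw [eichlerMap_apply, hxm]
    module
  rw [hr] at hx₂
  have hrd : r = d := by
    obtain ⟨T, hT, hTh⟩ := hx₂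
    have := hT h h
    rw [hTh, hd] at this
    simp only [map_add, map_smul, LinearMap.add_apply, LinearMap.smul_apply, h₁, h₂, h₃, h₃',
      smul_eq_mul] at this
    linarith
  rwa [hrd] at hx₂

end Eichler

/-! ### The congruence on `v*` as divisibility in the lattice -/

section Gamma

theorem exists_apply_eq_one_of_divisor {Λ : Type*} [AddCommGroup Λ] {B : LinearMap.BilinForm ℤ Λ}
    {h : Λ} (hd : divisor B h = 1) : ∃ y, B h y = 1 := by
  have hmem := Submodule.IsPrincipal.generator_mem (LinearMap.range (B h))
  rcases Int.natAbs_eq (Submodule.IsPrincipal.generator (LinearMap.range (B h))) with e | e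
  · rw [show (Submodule.IsPrincipal.generator (LinearMap.range (B h))).natAbs = 1 from hd] at e
    rw [e] at hmem
    exact hmem
  · rw [show (Submodule.IsPrincipal.generator (LinearMap.range (B h))).natAbs = 1 from hd] at e
    rw [e] at hmem
    obtain ⟨y, hy⟩ := hmem
    exact ⟨-y, by rw [map_neg, hy]; rfl⟩

theorem formL_vGen (d : ℕ) (x : LCarrier) : formL d vGen x = -2 * d * x.2.2.1 := by
  simp [formL, vGen, oplus_apply, rankOne_apply]

theorem divisor_vGen (d : ℕ) : divisor (formL d) vGen = 2 * d := by
  have hmem := Submodule.IsPrincipal.generator_mem (LinearMap.range (formL d vGen))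
  apply Nat.dvd_antisymm
  · have h : (-2 * d : ℤ) ∈ LinearMap.range (formL d vGen) := ⟨vGen, by rw [formL_vGen]; simp [vGen]⟩
    rw [Submodule.IsPrincipal.mem_iff_generator_dvd] at h
    have := Int.natAbs_dvd_natAbs.2 h
    simpa [Int.natAbs_mul, divisor] using this
  · obtain ⟨y, hy⟩ := hmem
    rw [formL_vGen] at hy
    have : (-2 * d : ℤ) ∣ Submodule.IsPrincipal.generator (LinearMap.range (formL d vGen)) :=
      ⟨_, hy.symm⟩
    simpa [Int.natAbs_mul, divisor] using Int.natAbs_dvd_natAbs.2 this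

theorem one_tmul_injective {Λ : Type*} [AddCommGroup Λ] [Module.Flat ℤ Λ] :
    Function.Injective fun x : Λ => (1 : ℚ) ⊗ₜ[ℤ] x := by
  have h := Module.Flat.rTensor_preserves_injective_linearMap (M := Λ)
    (Algebra.linearMap ℤ ℚ) (fun a b h => by simpa using h)
  intro x y hxy
  have : (1 : ℤ) ⊗ₜ[ℤ] x = (1 : ℤ) ⊗ₜ[ℤ] y := h (by simpa using hxy)
  simpa using congrArg (TensorProduct.lid ℤ Λ) this

/-- Clearing the denominator `div(v)` is reversible, since flatness embeds the lattice in its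
rational extension. -/
theorem mem_fixingModLattice_starVec_iff {Λ : Type*} [AddCommGroup Λ] [Module.Flat ℤ Λ]
    {B : LinearMap.BilinForm ℤ Λ} {v : Λ} (hv : divisor B v ≠ 0) {g : Λ ≃ₗ[ℤ] Λ} :
    g ∈ fixingModLattice B (starVec B v) ↔ g ∈ orthogonalGroupPlus B ∧
      ∃ l, g v - v = (divisor B v : ℤ) • l := by
  have hv' : (divisor B v : ℚ) ≠ 0 := by exact_mod_cast hv
  have key : g.baseChange ℤ ℚ Λ Λ (starVec B v) - starVec B v =
      ((divisor B v : ℚ)⁻¹) ⊗ₜ[ℤ] (g v - v) := by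
    rw [starVec, LinearEquiv.baseChange_tmul, TensorProduct.tmul_sub]
  refine and_congr_right fun _ => ?_
  rw [key]
  constructor
  · rintro ⟨l, hl⟩
    refine ⟨l, one_tmul_injective ?_⟩
    have hl' : (1 : ℚ) ⊗ₜ[ℤ] l = (divisor B v : ℚ)⁻¹ ⊗ₜ[ℤ] (g v - v) := hl
    have h2 := congrArg (fun z => (divisor B v : ℚ) • z) hl'
    simp only [TensorProduct.smul_tmul', smul_eq_mul,
      mul_inv_cancel₀ hv', mul_one] at h2
    simp only [TensorProduct.tmul_smul, TensorProduct.smul_tmul', zsmul_eq_mul, mul_one]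
    rw [← h2]
    norm_cast
  · rintro ⟨l, hl⟩
    refine ⟨l, ?_⟩
    change (1 : ℚ) ⊗ₜ[ℤ] l = _
    rw [hl, TensorProduct.tmul_smul, TensorProduct.smul_tmul', zsmul_eq_mul, Int.cast_natCast, mul_inv_cancel₀ hv']

theorem mem_Gam_iff {d : ℕ} (hd : d ≠ 0) {g : LCarrier ≃ₗ[ℤ] LCarrier} :
    g ∈ Gam d ↔ g ∈ orthogonalGroupPlus (formL d) ∧
      ∃ l, g vGen - vGen = (2 * d : ℤ) • l := by
  have h := mem_fixingModLattice_starVec_iff (B := formL d) (v := vGen) (g := g)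
    (by rw [divisor_vGen]; omega)
  rw [divisor_vGen] at h
  exact_mod_cast h

end Gamma

/-- Used with the relation that two isometries correspond under an embedding; uniqueness of the
partner yields multiplicativity. -/
theorem exists_monoidHom_of_rel {G H : Type*} [Group G] [Group H] (R : G → H → Prop)
    (hmul : ∀ g g' h h', R g h → R g' h' → R (g * g') (h * h')) (hex : ∀ g, ∃ h, R g h)
    (huniq : ∀ g h h', R g h → R g h' → h = h') : ∃ j : G →* H, ∀ g, R g (j g) := by
  choose j hj using hex
  exact ⟨MonoidHom.mk' j fun a b => huniq _ _ _ (hj _) (hmul _ _ _ _ (hj a) (hj b)), hj⟩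

/-! ### Part (2): `Γ_{2p²}` inside `Γ_2` -/

section Overlattice

/-- The automorphisms of `L_{2p²}` in `Γ_{2p²}` extend to `L_2`. -/
theorem exists_Gam_extension {p : ℕ} (hp : p ≠ 0) {g : LCarrier ≃ₗ[ℤ] LCarrier}
    (hg : g ∈ Gam (p ^ 2)) : ∃ g' ∈ Gam 1, ∀ x, g' (emb p x) = emb p (g x) := by
  have hpz : (p : ℤ) ≠ 0 := by exact_mod_cast hp
  have hp2 : p ^ 2 ≠ 0 := pow_ne_zero 2 hp
  let π : LCarrier →ₗ[ℤ] LCarrier :=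
    ((p : ℤ) • (LinearMap.id : (ℤ × ℤ) →ₗ[ℤ] ℤ × ℤ)).prodMap
      (((p : ℤ) • (LinearMap.id : (ℤ × ℤ) →ₗ[ℤ] ℤ × ℤ)).prodMap
        ((LinearMap.id : ℤ →ₗ[ℤ] ℤ).prodMap ((p : ℤ) • (LinearMap.id : ℤ →ₗ[ℤ] ℤ))))
  have hπ : ∀ m, emb p (π m) = (p : ℤ) • m := fun _ => rfl
  have hπ' : ∀ m : LCarrier, π m = (p : ℤ) • (m.1, m.2.1, 0, m.2.2.2) + m.2.2.1 • vGen := by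
    rintro ⟨x, y, a, b⟩
    simp [π, vGen]
  have hv : emb p vGen = (p : ℤ) • vGen := by simp [vGen, emb_apply]
  -- Only the `v`-component of `π m` is not already divisible by `p`; there `gv = v + 2p²l` and `emb
  -- p v = p v` suffice.
  have hdvd : ∀ g ∈ Gam (p ^ 2), ∀ m, ∃ y, (p : ℤ) • y = emb p (g (π m)) := by
    intro g hg m
    obtain ⟨-, l, hl⟩ := (mem_Gam_iff hp2).1 hg
    rw [sub_eq_iff_eq_add] at hl
    refine ⟨emb p (g (m.1, m.2.1, 0, m.2.2.2)) + m.2.2.1 • ((2 * p : ℤ) • emb p l + vGen), ?_⟩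
    rw [hπ', map_add, map_smul, map_smul, hl, map_add, map_smul, map_smul, map_add, map_smul, hv]
    push_cast
    module
  obtain ⟨g', hg'⟩ := exists_extension hpz (emb_injective p hp) hπ g (hdvd g hg)
    (hdvd g⁻¹ (inv_mem hg))
  obtain ⟨hO, l, hl⟩ := (mem_Gam_iff hp2).1 hg
  refine ⟨g', (mem_Gam_iff one_ne_zero).2 ⟨?_, (p : ℤ) • emb p l, ?_⟩, hg'⟩
  · refine mem_orthogonalGroupPlus_of_restrict (emb_isometric p) hg' hpz
      (fun m => ⟨π m, 0, by rw [hπ, add_zero], by simp, map_zero _⟩)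
      (extension_isometry hpz (emb_isometric p) hπ hg' hO.1) hO
  -- After multiplication by `p` the difference is `emb p (gv - v) = 2p² emb p l`.
  · refine smul_right_injective LCarrier hpz ?_
    change (p : ℤ) • (g' vGen - vGen) = (p : ℤ) • _
    rw [smul_sub, ← map_smul, ← hv, hg', ← map_sub, hl, map_smul]
    push_cast
    module

theorem exists_Gam_hom {p : ℕ} (hp : p ≠ 0) :
    ∃ j : Gam (p ^ 2) →* Gam 1, Function.Injective j ∧ ∀ (g : Gam (p ^ 2)) (x : LCarrier),
      (j g : LCarrier ≃ₗ[ℤ] LCarrier) (emb p x) = emb p ((g : LCarrier ≃ₗ[ℤ] LCarrier) x) := by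
  obtain ⟨j, hj⟩ := exists_monoidHom_of_rel (G := Gam (p ^ 2)) (H := Gam 1)
    (fun g g' => ∀ x, g'.1 (emb p x) = emb p (g.1 x))
    (fun g₁ g₂ h₁ h₂ H₁ H₂ x => by
      simp only [Subgroup.coe_mul, LinearEquiv.mul_apply, H₁, H₂])
    (fun g => by
      obtain ⟨g', h1, h2⟩ := exists_Gam_extension hp g.2
      exact ⟨⟨g', h1⟩, h2⟩)
    (fun g h h' H H' => Subtype.ext <| LinearEquiv.ext fun m => by
      have hpz : (p : ℤ) ≠ 0 := by exact_mod_cast hp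
      have e : (p : ℤ) • m = emb p ((p : ℤ) • m.1, (p : ℤ) • m.2.1, m.2.2.1, (p : ℤ) • m.2.2.2) :=
        rfl
      refine smul_right_injective LCarrier hpz ?_
      change (p : ℤ) • h.1 m = (p : ℤ) • h'.1 m
      rw [← map_smul, ← map_smul, e, H, H'])
  refine ⟨j, fun g h hgh => Subtype.ext <| LinearEquiv.ext fun x => emb_injective p hp ?_, hj⟩
  rw [← hj, hgh, hj]

end Overlattice

/-! ### Part (1): the orthogonal complement of `h` -/

section Perp

/-- The embedding of `L_{2d}` as the orthogonal complement of `e + d f` in `M`, where `e`, `f` is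
the standard basis of the first hyperbolic plane. -/
def perpEmb (d : ℕ) : LCarrier →ₗ[ℤ] MCarrier where
  toFun x := ((x.2.2.1, -(d * x.2.2.1)), x.1, x.2.1, x.2.2.2)
  map_add' x y := by ext <;> simp; ring
  map_smul' a x := by ext <;> simp; ring

/-- Multiplication by `2d` from `M` to `L_{2d} ⊕ ℤ (e + d f)`. -/
def perpProj (d : ℕ) : MCarrier →ₗ[ℤ] LCarrier × ℤ where
  toFun m := (((2 * d : ℤ) • m.2.1, (2 * d : ℤ) • m.2.2.1, d * m.1.1 - m.1.2,
    (2 * d : ℤ) • m.2.2.2), d * m.1.1 + m.1.2)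
  map_add' x y := by ext <;> simp <;> ring
  map_smul' a x := by ext <;> simp <;> ring

theorem formM_apply (x y : MCarrier) : formM x y = (x.1.1 * y.1.2 + x.1.2 * y.1.1) +
    ((x.2.1.1 * y.2.1.2 + x.2.1.2 * y.2.1.1) + ((x.2.2.1.1 * y.2.2.1.2 + x.2.2.1.2 * y.2.2.1.1) +
      -6 * (x.2.2.2 * y.2.2.2))) := rfl

theorem formL_apply (d : ℕ) (x y : LCarrier) : formL d x y =
    (x.1.1 * y.1.2 + x.1.2 * y.1.1) + ((x.2.1.1 * y.2.1.2 + x.2.1.2 * y.2.1.1) +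
      (-2 * (d : ℤ) * (x.2.2.1 * y.2.2.1) + -6 * (x.2.2.2 * y.2.2.2))) := rfl

/-- The lattice `h^⊥` for a vector `h` of divisor one and square `2d`, together with the gluing
vector `t = (h - v) / 2d`. -/
theorem exists_perp_embedding {d : ℕ} (hd : d ≠ 0) {h : MCarrier} (hh : formM h h = 2 * (d : ℤ))
    (hdiv : divisor formM h = 1) :
    ∃ (i : LCarrier →ₗ[ℤ] MCarrier) (π : MCarrier →ₗ[ℤ] LCarrier × ℤ) (t : MCarrier),
      Function.Injective i ∧ (∀ x y, formM (i x) (i y) = formL d x y) ∧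
      (∀ x, formM h x = 0 ↔ ∃ y, i y = x) ∧ (2 * d : ℤ) • t = h - i vGen ∧
      (∀ m, i (π m).1 + (π m).2 • h = (2 * d : ℤ) • m) ∧
      ∀ m, ∃ (x : LCarrier) (k : ℤ), (π m).1 = (2 * d : ℤ) • x + k • vGen := by
  obtain ⟨T, hT, hTh⟩ := sameOrbit_of_divisor_one formM_symm
    (fun x => ⟨x.1.1 * x.1.2 + x.2.1.1 * x.2.1.2 + x.2.2.1.1 * x.2.2.1.2 - 3 * (x.2.2.2 ^ 2),
      by rw [formM_apply]; ring⟩)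
    (e₁ := ((1, 0), 0, 0, 0)) (f₁ := ((0, 1), 0, 0, 0)) (e₂ := (0, (1, 0), 0, 0))
    (f₂ := (0, (0, 1), 0, 0)) rfl rfl rfl rfl rfl rfl rfl rfl rfl rfl hh
    (exists_apply_eq_one_of_divisor hdiv)
  have hd0 : (2 * d : ℤ) ≠ 0 := by simpa using hd
  have hTh' : T h = ((1, (d : ℤ)), 0, 0, 0) := by rw [hTh]; simp
  have hTs : ∀ x, T (T.symm x) = x := T.apply_symm_apply
  have hform : ∀ x y, formM (T.symm x) y = formM x (T y) := fun x y => by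
    rw [← hT, hTs]
  have hinj : Function.Injective (perpEmb d) := by
    rintro ⟨x, y, a, b⟩ ⟨x', y', a', b'⟩ e
    simp only [perpEmb, LinearMap.coe_mk, AddHom.coe_mk, Prod.mk.injEq] at e ⊢
    exact ⟨e.2.1, e.2.2.1, e.1.1, e.2.2.2⟩
  -- The model for `e + df` is transported by `T`. There `v` becomes `e - df`, so `h - v` becomes
  -- `2df` and `t` is the preimage of `f`.
  refine ⟨(T.symm : MCarrier →ₗ[ℤ] MCarrier) ∘ₗ perpEmb d,
    perpProj d ∘ₗ (T : MCarrier →ₗ[ℤ] MCarrier), T.symm ((0, 1), 0, 0, 0),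
    T.symm.injective.comp hinj, ?_, ?_, ?_, ?_, ?_⟩
  · intro x y
    simp only [LinearMap.comp_apply, LinearEquiv.coe_coe, hform, hTs]
    simp only [formM_apply, formL_apply, perpEmb, LinearMap.coe_mk, AddHom.coe_mk]
    ring
  · intro x
    rw [← hT, hTh', formM_apply]
    constructor
    · intro e
      refine ⟨((T x).2.1, (T x).2.2.1, (T x).1.1, (T x).2.2.2), T.injective ?_⟩
      simp only [LinearMap.comp_apply, LinearEquiv.coe_coe, hTs]
      simp only [perpEmb, LinearMap.coe_mk, AddHom.coe_mk]
      simp at e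
      ext <;> simp
      linarith
    · rintro ⟨y, rfl⟩
      simp only [LinearMap.comp_apply, LinearEquiv.coe_coe, hTs]
      simp [perpEmb]
  · apply T.injective
    simp only [LinearMap.comp_apply, LinearEquiv.coe_coe, map_smul, map_sub, hTs, hTh']
    simp only [perpEmb, vGen, LinearMap.coe_mk, AddHom.coe_mk]
    ext <;> simp
    ring
  · intro m
    apply T.injective
    simp only [LinearMap.comp_apply, LinearEquiv.coe_coe, map_smul, map_add, hTs, hTh']
    simp only [perpEmb, perpProj, LinearMap.coe_mk, AddHom.coe_mk]
    ext <;> simp <;> ring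
  · intro m
    refine ⟨((T m).2.1, (T m).2.2.1, 0, (T m).2.2.2), d * (T m).1.1 - (T m).1.2, ?_⟩
    simp only [LinearMap.comp_apply, LinearEquiv.coe_coe, perpProj, vGen, LinearMap.coe_mk,
      AddHom.coe_mk]
    ext <;> simp

/-- `O⁺(M, h)` is isomorphic to `Γ_{2d}`, compatibly with an isometry `h^⊥ ≅ L_{2d}`. -/
theorem exists_perp_isometry {d : ℕ} (hd : d ≠ 0) {h : MCarrier} (hh : formM h h = 2 * (d : ℤ))
    (hdiv : divisor formM h = 1) :
    ∃ (φ : LinearMap.BilinForm.IsometryEquiv (formM.restrict (perp formM h)) (formL d))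
      (Φ : orthogonalGroupPlusFixing formM h ≃* Gam d),
      ∀ (g : orthogonalGroupPlusFixing formM h) (x : perp formM h),
        ((φ.symm ((Φ g : LCarrier ≃ₗ[ℤ] LCarrier) (φ x)) : perp formM h) : MCarrier) =
          (g : MCarrier ≃ₗ[ℤ] MCarrier) (x : MCarrier) := by
  obtain ⟨i, π, t, hinj, hi, hperp, ht, hπ, hπv⟩ := exists_perp_embedding hd hh hdiv
  have hd0 : (2 * d : ℤ) ≠ 0 := by simpa using hd
  have hih : ∀ y, formM h (i y) = 0 := fun y => (hperp _).2 ⟨y, rfl⟩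
  have hih' : ∀ y, formM (i y) h = 0 := fun y => by rw [formM_symm, hih]
  have hrange : LinearMap.range i = perp formM h := by
    ext x
    rw [LinearMap.mem_range, ← hperp, perp, LinearMap.BilinForm.mem_orthogonal_iff]
    constructor
    · intro e z hz
      obtain ⟨a, rfl⟩ := Submodule.mem_span_singleton.1 hz
      change formM (a • h) x = 0
      rw [map_smul, LinearMap.smul_apply, e, smul_zero]
    · exact fun e => e h (Submodule.mem_span_singleton_self h)
  let ε : LCarrier ≃ₗ[ℤ] perp formM h :=
    (LinearEquiv.ofInjective i hinj).trans (LinearEquiv.ofEq _ _ hrange)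
  have hε : ∀ y, (ε y : MCarrier) = i y := fun _ => rfl
  let φ : LinearMap.BilinForm.IsometryEquiv (formM.restrict (perp formM h)) (formL d) :=
    { ε.symm with
      map_app' := fun x y => by
        obtain ⟨x, rfl⟩ := ε.surjective x
        obtain ⟨y, rfl⟩ := ε.surjective y
        change formL d (ε.symm (ε x)) (ε.symm (ε y)) = formM (i x) (i y)
        simp [hi] }
  have hΛ : ∀ g : MCarrier ≃ₗ[ℤ] MCarrier, g h = h → ∀ x, ∃ y k,
      (2 * d : ℤ) • x = i y + k ∧ (∀ z, formM k (i z) = 0) ∧ g k = k := fun g hg x =>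
    ⟨(π x).1, (π x).2 • h, (hπ x).symm,
      fun z => by rw [map_smul, LinearMap.smul_apply, hih, smul_zero], by rw [map_smul, hg]⟩
  have hrestrict : ∀ g ∈ orthogonalGroupPlusFixing formM h, ∃ g' ∈ Gam d,
      ∀ x, g (i x) = i (g' x) := by
    intro g hg
    have hstab : ∀ g ∈ orthogonalGroupPlusFixing formM h, ∀ x, ∃ y, i y = g (i x) := by
      intro g hg x
      rw [← hperp]
      conv_lhs => rw [← hg.2]
      rw [hg.1.1, hih]
    have hg' := inv_mem hg
    choose a ha using hstab g hg
    choose b hb using hstab g⁻¹ hg'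
    have e : ∀ x, g (g⁻¹ x) = x := g.apply_symm_apply
    have e' : ∀ x, g⁻¹ (g x) = x := g.symm_apply_apply
    let g' : LCarrier ≃ₗ[ℤ] LCarrier :=
      { toFun := a
        invFun := b
        map_add' := fun x y => hinj (by simp [ha])
        map_smul' := fun c x => hinj (by
          rw [RingHom.id_apply, ha, map_smul, map_smul, map_smul, ha])
        left_inv := fun x => hinj (by rw [hb, ha, e'])
        right_inv := fun x => hinj (by rw [ha, hb, e]) }
    have hgg' : ∀ x, g (i x) = i (g' x) := fun x => (ha x).symm
    have hO : g' ∈ orthogonalGroup (formL d) := fun x y => by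
      rw [← hi, ← hi, ← hgg', ← hgg', hg.1.1]
    refine ⟨g', (mem_Gam_iff hd).2 ⟨restrict_mem_orthogonalGroupPlus hi hgg' hd0 (hΛ g hg.2)
      formM_symm (formL_symm d) hasOrthogonalFrame_formM (hasOrthogonalFrame_formL hd) hO hg.1,
      ?_⟩, hgg'⟩
    -- As `g` fixes `h`, the vector `t - gt` is orthogonal to `h`, and `2d (t - gt) = gv - v`.
    obtain ⟨l, hl⟩ := (hperp (t - g t)).1 (by
      rw [map_sub, sub_eq_zero]
      conv_rhs => rw [← hg.2]
      rw [hg.1.1])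
    refine ⟨l, hinj ?_⟩
    have hv : i vGen = h - (2 * d : ℤ) • t := by rw [ht]; abel
    rw [map_sub, ← hgg', hv, map_sub, map_smul, hg.2, map_smul, hl]
    module
  have hextend : ∀ g' ∈ Gam d, ∃ g ∈ orthogonalGroupPlusFixing formM h,
      ∀ x, g (i x) = i (g' x) := by
    intro g' hg'
    -- The finite-index sublattice `h^⊥ ⊕ ℤh`, on which `g'` is extended by the identity on `h`.
    let i' : LCarrier × ℤ →ₗ[ℤ] MCarrier := i.coprod (LinearMap.toSpanSingleton ℤ MCarrier h)
    have hi'a : ∀ x, i' x = i x.1 + x.2 • h := fun _ => rfl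
    let G : (LCarrier ≃ₗ[ℤ] LCarrier) → ((LCarrier × ℤ) ≃ₗ[ℤ] LCarrier × ℤ) :=
      fun g => g.prodCongr (LinearEquiv.refl ℤ ℤ)
    have hG : ∀ g x, G g x = (g x.1, x.2) := fun _ _ => rfl
    have hi' : ∀ x y, formM (i' x) (i' y) = oplus (formL d) (rankOne (2 * d)) x y := by
      intro x y
      simp only [hi'a, map_add, LinearMap.add_apply, map_smul, LinearMap.smul_apply, hi, hih, hih',
        hh, oplus_apply, rankOne_apply, smul_eq_mul]
      ring
    have hinj' : Function.Injective i' := by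
      rw [injective_iff_map_eq_zero]
      rintro ⟨x, a⟩ hx
      rw [hi'a] at hx
      have e := congrArg (formM h) hx
      simp only [map_add, hih, map_smul, hh, smul_eq_mul, zero_add, map_zero, mul_eq_zero] at e
      have ha : a = 0 := e.resolve_right (by simpa using hd)
      subst ha
      rw [zero_smul, add_zero] at hx
      have hx0 : x = 0 := (map_eq_zero_iff i hinj).1 hx
      rw [hx0]
      rfl
    have hdvd : ∀ g ∈ Gam d, ∀ m, ∃ y, (2 * d : ℤ) • y = i' (G g (π m)) := by
      intro g hg m
      obtain ⟨-, l, hl⟩ := (mem_Gam_iff hd).1 hg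
      rw [sub_eq_iff_eq_add] at hl
      -- Modulo `2d`, the `L_{2d}`-component of `2d m` is a multiple of `v`, the one vector
      -- controlled by the congruence.
      obtain ⟨x, k, hx⟩ := hπv m
      have hm := hπ m
      refine ⟨i (g x) + k • i l + m - i x, ?_⟩
      rw [hi'a, hG]
      simp only [hx, map_add, map_smul, hl, smul_add, smul_sub] at hm ⊢
      rw [← hm]
      module
    obtain ⟨g, hg⟩ := exists_extension hd0 hinj' (fun m => (hi'a _).trans (hπ m)) (G g')
      (hdvd g' hg') (hdvd g'⁻¹ (inv_mem hg'))
    have hgi : ∀ x, g (i x) = i (g' x) := fun x => by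
      simpa [hi'a, hG] using hg (x, 0)
    have hgh : g h = h := by simpa [hi'a, hG] using hg (0, 1)
    obtain ⟨hO, -⟩ := (mem_Gam_iff hd).1 hg'
    have hgO : g ∈ orthogonalGroup formM :=
      extension_isometry hd0 hi' (fun m => (hi'a _).trans (hπ m)) hg fun x y => by
        rw [oplus_apply, hG, hG, hO.1]
        rfl
    exact ⟨g, ⟨mem_orthogonalGroupPlus_of_restrict hi hgi hd0 (hΛ g hgh) hgO hO, hgh⟩, hgi⟩
  obtain ⟨Φ, hΦ⟩ := exists_monoidHom_of_rel (G := orthogonalGroupPlusFixing formM h) (H := Gam d)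
    (fun g g' => ∀ x, g.1 (i x) = i (g'.1 x))
    (fun g₁ g₂ h₁ h₂ H₁ H₂ x => by
      simp only [Subgroup.coe_mul, LinearEquiv.mul_apply, H₁, H₂])
    (fun g => by
      obtain ⟨g', h1, h2⟩ := hrestrict g.1 g.2
      exact ⟨⟨g', h1⟩, h2⟩)
    (fun g h h' H H' => Subtype.ext <| LinearEquiv.ext fun x => hinj ((H x).symm.trans (H' x)))
  -- An isometry fixing `h` is determined on `h^⊥`, because `2d M ⊆ h^⊥ ⊕ ℤh`.
  have huniq : ∀ g₁ g₂ : orthogonalGroupPlusFixing formM h,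
      (∀ x, g₁.1 (i x) = g₂.1 (i x)) → g₁ = g₂ := by
    intro g₁ g₂ H
    refine Subtype.ext <| LinearEquiv.ext fun m => smul_right_injective MCarrier hd0 ?_
    change (2 * d : ℤ) • g₁.1 m = (2 * d : ℤ) • g₂.1 m
    rw [← map_smul, ← map_smul, ← hπ, map_add, map_add, H, map_smul, map_smul, g₁.2.2, g₂.2.2]
  refine ⟨φ, MulEquiv.ofBijective Φ ⟨fun g₁ g₂ e => huniq _ _ fun x => by rw [hΦ, hΦ, e],
    fun g' => ?_⟩, fun g x => ?_⟩
  · obtain ⟨g, h1, h2⟩ := hextend g'.1 g'.2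
    refine ⟨⟨g, h1⟩, Subtype.ext <| LinearEquiv.ext fun x => hinj ?_⟩
    rw [← hΦ, h2]
  · obtain ⟨y, rfl⟩ := ε.surjective x
    have e : φ (ε y) = y := ε.symm_apply_apply y
    rw [e, hε]
    exact (hΦ g y).symm

end Perp

end KummerLattice

end

theorem proposition2p1 :
    (∀ (d : ℕ) (h : KummerLattice.MCarrier),
      4 < 2 * d →
      KummerLattice.formM h h = 2 * (d : ℤ) →
      KummerLattice.divisor KummerLattice.formM h = 1 →
      ∃ (φ : LinearMap.BilinForm.IsometryEquiv
          (KummerLattice.formM.restrict (KummerLattice.perp KummerLattice.formM h))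
          (KummerLattice.formL d))
        (Φ : KummerLattice.orthogonalGroupPlusFixing KummerLattice.formM h ≃*
          KummerLattice.Gam d),
        ∀ (g : KummerLattice.orthogonalGroupPlusFixing KummerLattice.formM h)
          (x : KummerLattice.perp KummerLattice.formM h),
          ((φ.symm ((Φ g : KummerLattice.LCarrier ≃ₗ[ℤ] KummerLattice.LCarrier) (φ x)) :
            KummerLattice.perp KummerLattice.formM h) : KummerLattice.MCarrier) =
          (g : KummerLattice.MCarrier ≃ₗ[ℤ] KummerLattice.MCarrier) (x : KummerLattice.MCarrier)) ∧
    (∀ p : ℕ, p.Prime → 3 < p →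
      ∃ j : KummerLattice.Gam (p ^ 2) →* KummerLattice.Gam 1,
        Function.Injective j ∧
        ∀ (g : KummerLattice.Gam (p ^ 2)) (x : KummerLattice.LCarrier),
          (j g : KummerLattice.LCarrier ≃ₗ[ℤ] KummerLattice.LCarrier) (KummerLattice.emb p x) =
            KummerLattice.emb p
              ((g : KummerLattice.LCarrier ≃ₗ[ℤ] KummerLattice.LCarrier) x)) :=
  ⟨fun _ _ hd hh hdiv => KummerLattice.exists_perp_isometry (by omega) hh hdiv,
    fun _ hp _ => KummerLattice.exists_Gam_hom hp.ne_zero⟩
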